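/- **Theorem 4.6.** Let $\mathcal M$ be a matroid on a finite ground set $X$ with rank function $r_{\mathcal M}$ and set of bases $\mathcal B$, let $f:2^X\to\mathbb R_{\ge 0}$ be a submodular function, $F(\mathbf x)=\sum_{S\subseteq X}f(S)\prod_{i\in S}x_i\prod_{j\notin S}(1-x_j)$ its multilinear extension, and $OPT=\max\{f(B):B\in\mathcal B\}$. Suppose that there is a fractional packing of $\nu\in[1,2]$ bases in $\mathcal M$, i.e. weights $\alpha_B\ge 0$ ($B\in\mathcal B$) with $\sum_{B}\alpha_B=\nu$ and $\sum_{B\ni j}\alpha_B\le 1$ for every $j\in X$. Let $t=1/\nu$ and suppose $t=r/q$ with positive integers $r\le q$; put $\delta=1/q$ and $B_t(\mathcal M)=\operatorname{conv}\{\mathbf 1_B:B\in\mathcal B\}\cap[0,t]^X$. Consider the following algorithm. 1. Start at any $\mathbf x\in B_t(\mathcal M)$ all of whose coordinates are integer multiples of $\delta$. 2. (Fractional local search.) While there is a direction $\mathbf v=\mathbf e_j-\mathbf e_i$ ($i,j\in X$) with $\mathbf x+\delta\mathbf v\in B_t(\mathcal M)$ and $F(\mathbf x+\delta\mathbf v)>F(\mathbf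 x)$, choose any such direction and replace $\mathbf x$ by $\mathbf x+\delta\mathbf v$. 3. (Randomized pipage rounding.) Set $\mathbf y:=\mathbf x$. While $\mathbf y$ is not integral: set $T:=X$ and, while $T$ contains an element $k$ with $y_k\notin\mathbb Z$, pick any two distinct $i,j\in T$ with $y_i,y_j\notin\mathbb Z$, compute $(\mathbf y^+,A^+)=\mathrm{HitConstraint}(\mathbf y,i,j)$ and $(\mathbf y^-,A^-)=\mathrm{HitConstraint}(\mathbf y,j,i)$, and with probability $p=\|\mathbf y^+-\mathbf y\|/\|\mathbf y^+-\mathbf y^-\|$ (an arbitrary $p\in[0,1]$ if $\mathbf y^+=\mathbf y^-=\mathbf y$) replace $(\mathbf y,T)$ by $(\mathbf y^-,T\cap A^-)$, and otherwise by $(\mathbf y^+,T\cap A^+)$. Finally return the set $\{i:y_i=1\}$. Here $\mathrm{HitConstraint}(\mathbf y,i,j)$ takes any $A$ minimizing $r_{\mathcal M}(A)-\sum_{k\in A}y_k$ over all $A\subseteq X$ with $i\in A$, $j\notin A$, and lets $\eta$ be the minimum; if $y_j<\eta$, it resets $\eta:=y_j$ and $A:=\{j\}$; it returns $(\mathbf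 y+\eta(\mathbf e_i-\mathbf e_j),A)$. Then, for every way of making the choices left open, the algorithm can be carried out (in particular, a starting point as in step 1 exists), it always terminates, and it returns a random set that is always a base $B\in\mathcal B$ and satisfies $$\mathbf E[f(B)]\ \ge\ \tfrac12(1-t)\,OPT .$$ -/

import Mathlib

namespace SubmodBases

variable {X : Type*} [Fintype X] [DecidableEq X]

/-- A set function is submodular if `f (S ∪ T) + f (S ∩ T) ≤ f S + f T` for all `S`, `T`. -/
def IsSubmodular (f : Finset X → ℝ) : Prop :=
  ∀ S T : Finset X, f (S ∪ T) + f (S ∩ T) ≤ f S + f T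

/-- The multilinear extension
`F(x) = ∑_{S ⊆ X} f(S) ∏_{i ∈ S} x_i ∏_{j ∉ S} (1 - x_j)`. -/
noncomputable def multilinear (f : Finset X → ℝ) (x : X → ℝ) : ℝ :=
  ∑ S : Finset X, f S * ((∏ i ∈ S, x i) * ∏ j ∈ Sᶜ, (1 - x j))

/-- The real-valued rank function of a matroid on a finite type (where `eRk` is finite). -/
noncomputable def rank (M : Matroid X) (A : Finset X) : ℝ :=
  ((M.eRk (A : Set X)).toNat : ℝ)

/-- The indicator vector of a set. -/
def indicatorVec (S : Finset X) : X → ℝ := fun i => if i ∈ S then 1 else 0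

/-- The standard basis vector `e_i`. -/
def basisVec (i : X) : X → ℝ := Pi.single i 1

/-- The base polytope: the convex hull of the indicator vectors of the bases. -/
def basePolytope (M : Matroid X) : Set (X → ℝ) :=
  convexHull ℝ {x | ∃ B : Finset X, M.IsBase (B : Set X) ∧ x = indicatorVec B}

/-- The base polytope intersected with the box `[0, t]^X`. -/
def boxedBasePolytope (M : Matroid X) (t : ℝ) : Set (X → ℝ) :=
  {x | x ∈ basePolytope M ∧ ∀ i, 0 ≤ x i ∧ x i ≤ t}

/-- A fractional packing of `ν` bases: nonnegative weights on the bases, of total weight `ν`,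
such that the bases containing any given element have total weight at most `1`. -/
def HasFractionalBasePacking (M : Matroid X) (ν : ℝ) : Prop :=
  ∃ α : Finset X → ℝ, (∀ B, 0 ≤ α B) ∧ (∀ B, α B ≠ 0 → M.IsBase (B : Set X)) ∧
    (∀ j : X, ∑ B : Finset X with j ∈ B, α B ≤ 1) ∧ ∑ B : Finset X, α B = ν

/-- The optimum `max {f(B) : B a base}` (a supremum over a finite nonempty set). -/
noncomputable def opt (M : Matroid X) (f : Finset X → ℝ) : ℝ :=
  sSup (f '' {B : Finset X | M.IsBase (B : Set X)})

/-- A real number is integral. -/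
def IsIntegerValued (a : ℝ) : Prop := ∃ n : ℤ, a = n

/-- `slack M y A = r_M(A) - y(A)`. -/
noncomputable def slack (M : Matroid X) (y : X → ℝ) (A : Finset X) : ℝ :=
  rank M A - ∑ k ∈ A, y k

/-- `A` minimizes `r_M(A) - y(A)` over the sets containing `i` and not containing `j`. -/
def IsTightest (M : Matroid X) (y : X → ℝ) (i j : X) (A : Finset X) : Prop :=
  i ∈ A ∧ j ∉ A ∧ ∀ A' : Finset X, i ∈ A' → j ∉ A' → slack M y A ≤ slack M y A'

/-- The subroutine `HitConstraint (y, i, j)`, as the relation between its input and the pairs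
`(y', A)` that it may return (minimizers need not be unique). It increases `y i` and decreases
`y j` by the same amount `δ`, namely the least slack, or `y j` if this is smaller. -/
inductive HitConstraint (M : Matroid X) (y : X → ℝ) (i j : X) : (X → ℝ) → Finset X → Prop
  | tight (A : Finset X) (hA : IsTightest M y i j A) (hle : slack M y A ≤ y j) :
      HitConstraint M y i j (y + slack M y A • (basisVec i - basisVec j)) A
  | zero (A : Finset X) (hA : IsTightest M y i j A) (hlt : y j < slack M y A) :
      HitConstraint M y i j (y + y j • (basisVec i - basisVec j)) {j}

/-- The states of the whole algorithm: before the choice of a starting point; in the local search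
at a point `x`; in the pipage rounding with current point `y` and current set `T`; finished. -/
inductive State (X : Type*)
  | start : State X
  | search (x : X → ℝ) : State X
  | round (y : X → ℝ) (T : Finset X) : State X
  | done (B : Finset X) : State X

/-- `x + δ v` with `v = e_j - e_i` is an improving feasible step of the local search at `x`. -/
def IsImproving (M : Matroid X) (f : Finset X → ℝ) (t δ : ℝ) (x : X → ℝ) (i j : X) : Prop :=
  x + δ • (basisVec j - basisVec i) ∈ boxedBasePolytope M t ∧
    multilinear f x < multilinear f (x + δ • (basisVec j - basisVec i))

open Classical in
/-- Fractional local search in the boxed base polytope with step `δ`, followed by pipage rounding.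
`Step M f t δ s p s₁ s₂` says that from the state `s` the algorithm may proceed to `s₁` with
probability `p` and to `s₂` with probability `1 - p`. Deterministic steps have `s₁ = s₂`.
Every choice that the algorithm leaves open (the starting point, the improving direction,
the fractional pair `i, j`, the minimizer in `HitConstraint`) is left open here too. -/
inductive Step (M : Matroid X) (f : Finset X → ℝ) (t δ : ℝ) :
    State X → ℝ → State X → State X → Prop
  /-- Start at a point of the boxed base polytope with coordinates integer multiples of `δ`. -/
  | start (x : X → ℝ) (hx : x ∈ boxedBasePolytope M t) (hgrid : ∀ i, ∃ n : ℤ, x i = n * δ) :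
      Step M f t δ .start 1 (.search x) (.search x)
  /-- Take an improving step. -/
  | improve (x : X → ℝ) (i j : X) (h : IsImproving M f t δ x i j) :
      Step M f t δ (.search x) 1 (.search (x + δ • (basisVec j - basisVec i)))
        (.search (x + δ • (basisVec j - basisVec i)))
  /-- If there is no improving step, call pipage rounding (with `T = X`). -/
  | finish (x : X → ℝ) (h : ∀ i j, ¬ IsImproving M f t δ x i j) :
      Step M f t δ (.search x) 1 (.round x Finset.univ) (.round x Finset.univ)
  /-- Inner loop of pipage rounding: `T` contains fractional variables; pick two of them. The
  probability is `p = ‖y⁺ - y‖ / ‖y⁺ - y⁻‖`, and any `p` if this reads `0 / 0` (then `y⁺ = y⁻ = y`).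
  The differences are parallel, so the choice of the norm does not matter. -/
  | pipage (y : X → ℝ) (T : Finset X) (i j : X) (hij : i ≠ j) (hi : i ∈ T) (hj : j ∈ T)
      (hfi : ¬ IsIntegerValued (y i)) (hfj : ¬ IsIntegerValued (y j))
      (yplus yminus : X → ℝ) (Aplus Aminus : Finset X)
      (hplus : HitConstraint M y i j yplus Aplus)
      (hminus : HitConstraint M y j i yminus Aminus)
      (p : ℝ) (hp0 : 0 ≤ p) (hp1 : p ≤ 1) (hp : p * ‖yplus - yminus‖ = ‖yplus - y‖) :
      Step M f t δ (.round y T) p (.round yminus (T ∩ Aminus)) (.round yplus (T ∩ Aplus))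
  /-- Outer loop of pipage rounding: `T` contains no fractional variable but `y` is not integral. -/
  | restart (y : X → ℝ) (T : Finset X) (hT : ∀ i ∈ T, IsIntegerValued (y i))
      (hy : ∃ i, ¬ IsIntegerValued (y i)) :
      Step M f t δ (.round y T) 1 (.round y Finset.univ) (.round y Finset.univ)
  /-- The point `y` is integral: return the set that it represents. -/
  | output (y : X → ℝ) (T : Finset X) (hy : ∀ i, IsIntegerValued (y i)) :
      Step M f t δ (.round y T) 1 (.done (Finset.univ.filter fun i => y i = 1))
        (.done (Finset.univ.filter fun i => y i = 1))

/-- `s'` is a possible next state after `s`. -/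
def Next (M : Matroid X) (f : Finset X → ℝ) (t δ : ℝ) (s s' : State X) : Prop :=
  ∃ p s₁ s₂, Step M f t δ s p s₁ s₂ ∧ (s' = s₁ ∨ s' = s₂)

/-- Started in the state `s`, the algorithm always halts with an answer: no execution is infinite,
and none reaches a state that is not final and from which it cannot proceed. -/
def Halts (M : Matroid X) (f : Finset X → ℝ) (t δ : ℝ) (s : State X) : Prop :=
  (¬ ∃ u : ℕ → State X, u 0 = s ∧ ∀ n, Next M f t δ (u n) (u (n + 1))) ∧
    ∀ s', Relation.ReflTransGen (Next M f t δ) s s' →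
      (∃ B, s' = .done B) ∨ ∃ s'', Next M f t δ s' s''

/-- `Returns M f t δ s μ`: for some way of making the open choices (which may depend on the outcomes
of the coin tosses so far), `μ B` is the probability that the algorithm, started in `s`,
returns `B`. -/
inductive Returns (M : Matroid X) (f : Finset X → ℝ) (t δ : ℝ) :
    State X → (Finset X → ℝ) → Prop
  | done (B : Finset X) : Returns M f t δ (.done B) (Pi.single B 1)
  | step (s : State X) (p : ℝ) (s₁ s₂ : State X) (μ₁ μ₂ : Finset X → ℝ)
      (h : Step M f t δ s p s₁ s₂) (h₁ : Returns M f t δ s₁ μ₁) (h₂ : Returns M f t δ s₂ μ₂) :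
      Returns M f t δ s (p • μ₁ + (1 - p) • μ₂)

end SubmodBases

namespace SubmodBases

variable {X : Type*} [Fintype X] [DecidableEq X]

set_option linter.unusedSectionVars false

/-! The analysis of the local search rests on two second-order facts about the multilinear extension
`F` of a submodular `f`: mixed partial derivatives are nonpositive, so `F` is concave along
nonnegative directions (`multilinear_concave_of_le`) and convex along `e_i - e_j`
(`multilinear_add_smul_ge`).

Let `x` be a local optimum, `x = ∑ β_B 1_B` a convex combination of bases, `C` an optimal base and
`K` the set of `k ∈ C` with `x_k < t`. For each `B` in the combination, Hall's theorem matches `C \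
B` into `B \ C` by single exchanges (`exists_exchange_matching`). On the grid every strict
inequality has a gap of at least `δ`, so each exchange bringing in an element of `K` is a feasible
step (`exchange_mem_boxedBasePolytope`). It does not improve, and convexity turns this into an
inequality between partial derivatives. Averaging over `B` and using concavity gives `F(x ∨ 1_K) +
F(x - m) ≤ 2 F(x)` for some `0 ≤ m ≤ x` vanishing on `C` (`exists_lowering_of_matching`). Zeroing
the coordinates off `C`, all at most `t`, costs a factor `1 - t` in both terms
(`multilinear_piecewise_zero_le`), and the two truncated values sum to at least `f(C)` because `t ≥
1/2` (`le_multilinear_add_multilinear`).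

In the rounding, every step moves along a line `e_i - e_j` with mean zero, so the expectation of `F`
does not drop. Tight sets are closed under intersection, which keeps `T` tight until it has no
fractional element (`hitConstraint_step`); each step lowers an integer measure. Since the
coordinates are martingales, the rounding also proves that the rank inequalities describe the base
polytope (`mem_basePolytope_iff_memBasePolyhedron`). The local search stops because `F` strictly
increases on a finite grid; a start comes from a maximal grid point of the independence polytope in
the box (`exists_gridPoint`). -/

/-! ### Calculus of the multilinear extension. -/

/-- The discrete derivative of a set function in direction `i`. -/
def discreteDeriv (i : X) (f : Finset X → ℝ) : Finset X → ℝ :=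
  fun S => f (insert i S) - f (S.erase i)

/-- The partial derivative of the multilinear extension. -/
noncomputable def partialDeriv (i : X) (f : Finset X → ℝ) (x : X → ℝ) : ℝ :=
  multilinear (discreteDeriv i f) x

/-- Pairing `S` with `insert i S` isolates the coordinate `x i`; the remaining weight does not
involve it. This makes affinity in each variable visible. -/
theorem multilinear_eq_sum_erase (f : Finset X → ℝ) (x : X → ℝ) (i : X) :
    multilinear f x = ∑ S ∈ (Finset.univ.erase i).powerset,
      (x i * f (insert i S) + (1 - x i) * f S) *
        ((∏ k ∈ S, x k) * ∏ k ∈ (insert i S)ᶜ, (1 - x k)) := by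
  have h : (Finset.univ : Finset (Finset X)) = (insert i (Finset.univ.erase i)).powerset := by
    ext S; simp
  rw [multilinear, h, Finset.sum_powerset_insert (by simp), ← Finset.sum_add_distrib]
  refine Finset.sum_congr rfl fun S hS => ?_
  have hi : i ∉ S := fun hi => by simpa using Finset.mem_powerset.1 hS hi
  have h1 : Sᶜ = insert i (insert i S)ᶜ := by
    ext k; by_cases hk : k = i <;> simp [hk, hi]
  rw [h1, Finset.prod_insert hi, Finset.prod_insert (by simp)]
  ring

theorem multilinear_update (f : Finset X → ℝ) (x : X → ℝ) (i : X) (s : ℝ) :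
    multilinear f (Function.update x i s) =
      multilinear f x + (s - x i) * partialDeriv i f x := by
  rw [partialDeriv, multilinear_eq_sum_erase f _ i, multilinear_eq_sum_erase f x i,
    multilinear_eq_sum_erase (discreteDeriv i f) x i, Finset.mul_sum, ← Finset.sum_add_distrib]
  refine Finset.sum_congr rfl fun S hS => ?_
  have hi : i ∉ S := fun hi => by simpa using Finset.mem_powerset.1 hS hi
  have h1 : ∏ k ∈ S, Function.update x i s k = ∏ k ∈ S, x k :=
    Finset.prod_congr rfl fun k hk => Function.update_of_ne (by rintro rfl; exact hi hk) _ _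
  have h2 : ∏ k ∈ (insert i S)ᶜ, (1 - Function.update x i s k) = ∏ k ∈ (insert i S)ᶜ, (1 - x k) :=
    Finset.prod_congr rfl fun k hk => by
      rw [Function.update_of_ne (fun h => by simp [h] at hk)]
  simp only [h1, h2, Function.update_self, discreteDeriv, Finset.insert_idem,
    Finset.erase_insert hi, Finset.erase_eq_of_notMem hi]
  ring

theorem sum_multilinear_weights (x : X → ℝ) :
    ∑ S : Finset X, ((∏ i ∈ S, x i) * ∏ j ∈ Sᶜ, (1 - x j)) = 1 := by
  have := Finset.prod_add x (fun i => 1 - x i) (Finset.univ : Finset X)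
  simpa [Finset.compl_eq_univ_sdiff] using this.symm

/-- `F(x)` is the mean of `f` over a random set containing each `i` independently with probability
`x i`; only sets of positive probability matter. -/
theorem multilinear_le_of_forall {f : Finset X → ℝ} {x : X → ℝ}
    (hx : ∀ i, 0 ≤ x i ∧ x i ≤ 1) (c : ℝ)
    (h : ∀ S : Finset X, (∀ i, x i = 1 → i ∈ S) → (∀ i ∈ S, x i ≠ 0) → c ≤ f S) :
    c ≤ multilinear f x := by
  rw [← one_mul c, ← sum_multilinear_weights x, Finset.sum_mul, multilinear]
  refine Finset.sum_le_sum fun S _ => ?_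
  rw [mul_comm]
  by_cases h0 : (∏ i ∈ S, x i) * ∏ j ∈ Sᶜ, (1 - x j) = 0
  · simp [h0]
  · refine mul_le_mul_of_nonneg_right (h S ?_ ?_) (mul_nonneg
      (Finset.prod_nonneg fun i _ => (hx i).1)
      (Finset.prod_nonneg fun i _ => sub_nonneg.2 (hx i).2))
    · intro i hi
      by_contra hS
      exact h0 (mul_eq_zero_of_right _
        (Finset.prod_eq_zero (Finset.mem_compl.2 hS) (by simp [hi])))
    · intro i hi hxi
      exact h0 (mul_eq_zero_of_left (Finset.prod_eq_zero hi hxi) _)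

theorem multilinear_nonneg {f : Finset X → ℝ} (hf : ∀ S, 0 ≤ f S) {x : X → ℝ}
    (hx : ∀ i, 0 ≤ x i ∧ x i ≤ 1) : 0 ≤ multilinear f x :=
  multilinear_le_of_forall hx 0 fun S _ _ => hf S

theorem multilinear_indicatorVec (f : Finset X → ℝ) (B : Finset X) :
    multilinear f (indicatorVec B) = f B := by
  rw [multilinear, Finset.sum_eq_single B]
  · rw [Finset.prod_eq_one fun i hi => by simp [indicatorVec, hi],
      Finset.prod_eq_one fun i hi => by simp [indicatorVec, Finset.mem_compl.1 hi]]
    simp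
  · intro S _ hS
    by_cases h : S ⊆ B
    · obtain ⟨k, hk, hkS⟩ : ∃ k ∈ B, k ∉ S := by
        by_contra! h'
        exact hS (h.antisymm h')
      rw [Finset.prod_eq_zero (i := k) (s := Sᶜ) (by simpa using hkS) (by simp [indicatorVec, hk])]
      simp
    · obtain ⟨k, hk, hkB⟩ := Finset.not_subset.1 h
      rw [Finset.prod_eq_zero (i := k) (s := S) hk (by simp [indicatorVec, hkB])]
      simp
  · simp

theorem discreteDeriv_discreteDeriv_nonpos {f : Finset X → ℝ} (hf : IsSubmodular f) {i j : X}
    (hij : i ≠ j) (S : Finset X) : discreteDeriv i (discreteDeriv j f) S ≤ 0 := by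
  simp only [discreteDeriv]
  have h := hf (insert j (S.erase i)) ((insert i S).erase j)
  have h1 : insert j (S.erase i) ∪ (insert i S).erase j = insert j (insert i S) := by
    ext k; simp only [Finset.mem_union, Finset.mem_insert, Finset.mem_erase]; tauto
  have h2 : insert j (S.erase i) ∩ (insert i S).erase j = (S.erase i).erase j := by
    ext k; simp only [Finset.mem_inter, Finset.mem_insert, Finset.mem_erase]; tauto
  rw [h1, h2] at h
  linarith

theorem discreteDeriv_self (i : X) (f : Finset X → ℝ) (S : Finset X) :
    discreteDeriv i (discreteDeriv i f) S = 0 := by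
  have h1 : insert i (S.erase i) = insert i S := by
    ext k; simp only [Finset.mem_insert, Finset.mem_erase]; tauto
  have h2 : (insert i S).erase i = S.erase i := by
    ext k; simp only [Finset.mem_insert, Finset.mem_erase]; tauto
  simp [discreteDeriv, h1, h2]

theorem partialDeriv_discreteDeriv_nonpos {f : Finset X → ℝ} (hf : IsSubmodular f) {x : X → ℝ}
    (hx : ∀ i, 0 ≤ x i ∧ x i ≤ 1) (i j : X) :
    partialDeriv i (discreteDeriv j f) x ≤ 0 := by
  rcases eq_or_ne i j with rfl | hij
  · simp [partialDeriv, multilinear, discreteDeriv_self]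
  · have h : 0 ≤ multilinear (fun S => -discreteDeriv i (discreteDeriv j f) S) x :=
      multilinear_nonneg
        (fun S => neg_nonneg.2 (discreteDeriv_discreteDeriv_nonpos hf hij S)) hx
    simpa [multilinear, partialDeriv] using h

/-- Raise the coordinates from `x` to `y` one at a time: by affinity each change is `y j - x j`
times the partial derivative at a point between `x` and `y`. -/
theorem multilinear_sub_le_sum {f : Finset X → ℝ} {x y : X → ℝ} (hxy : ∀ i, x i ≤ y i) (c : X → ℝ)
    (h : ∀ z, (∀ i, x i ≤ z i ∧ z i ≤ y i) → ∀ j, partialDeriv j f z ≤ c j) :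
    multilinear f y - multilinear f x ≤ ∑ j, (y j - x j) * c j := by
  suffices H : ∀ U : Finset X,
      multilinear f (U.piecewise y x) - multilinear f x ≤ ∑ j ∈ U, (y j - x j) * c j by
    simpa using H Finset.univ
  intro U
  induction U using Finset.induction_on with
  | empty => simp
  | insert j U hj ih =>
    rw [Finset.piecewise_insert, multilinear_update, Finset.sum_insert hj,
      Finset.piecewise_eq_of_notMem _ _ _ hj]
    have hz : ∀ i, x i ≤ U.piecewise y x i ∧ U.piecewise y x i ≤ y i := fun i => by
      by_cases hi : i ∈ U <;> simp [hi, hxy i]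
    have := mul_le_mul_of_nonneg_left (h _ hz j) (sub_nonneg.2 (hxy j))
    linarith

/-- A partial derivative is itself the multilinear extension of a discrete derivative, and its own
partial derivatives are nonpositive. -/
theorem partialDeriv_anti {f : Finset X → ℝ} (hf : IsSubmodular f) {x y : X → ℝ}
    (hx : ∀ i, 0 ≤ x i) (hxy : ∀ i, x i ≤ y i) (hy : ∀ i, y i ≤ 1) (j : X) :
    partialDeriv j f y ≤ partialDeriv j f x := by
  have := multilinear_sub_le_sum (f := discreteDeriv j f) hxy (fun _ => 0) fun z hz i =>
    partialDeriv_discreteDeriv_nonpos hf (fun k => ⟨(hx k).trans (hz k).1, (hz k).2.trans (hy k)⟩)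
      i j
  simpa [partialDeriv] using this

theorem multilinear_sub_le {f : Finset X → ℝ} (hf : IsSubmodular f) {x y : X → ℝ}
    (hx : ∀ i, 0 ≤ x i) (hxy : ∀ i, x i ≤ y i) (hy : ∀ i, y i ≤ 1) :
    multilinear f y - multilinear f x ≤ ∑ j, (y j - x j) * partialDeriv j f x :=
  multilinear_sub_le_sum hxy _ fun _ hz j =>
    partialDeriv_anti hf hx (fun i => (hz i).1) (fun i => (hz i).2.trans (hy i)) j

theorem multilinear_neg (f : Finset X → ℝ) (x : X → ℝ) :
    multilinear (fun S => -f S) x = -multilinear f x := by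
  simp [multilinear]

theorem partialDeriv_neg (f : Finset X → ℝ) (x : X → ℝ) (j : X) :
    partialDeriv j (fun S => -f S) x = -partialDeriv j f x := by
  rw [partialDeriv, partialDeriv, ← multilinear_neg]
  congr 1; ext S; simp only [discreteDeriv]; ring

theorem le_multilinear_sub {f : Finset X → ℝ} (hf : IsSubmodular f) {x y : X → ℝ}
    (hx : ∀ i, 0 ≤ x i) (hxy : ∀ i, x i ≤ y i) (hy : ∀ i, y i ≤ 1) :
    ∑ j, (y j - x j) * partialDeriv j f y ≤ multilinear f y - multilinear f x := by
  have := multilinear_sub_le_sum (f := fun S => -f S) hxy (fun j => -partialDeriv j f y)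
    fun z hz j => by
      rw [partialDeriv_neg]
      exact neg_le_neg (partialDeriv_anti hf (fun i => (hx i).trans (hz i).1)
        (fun i => (hz i).2) hy j)
  simp only [multilinear_neg, mul_neg, Finset.sum_neg_distrib] at this
  linarith

/-- The multilinear extension of a submodular function is concave along nonnegative directions. -/
theorem multilinear_concave_of_le {f : Finset X → ℝ} (hf : IsSubmodular f) {x y : X → ℝ}
    (hx : ∀ i, 0 ≤ x i) (hxy : ∀ i, x i ≤ y i) (hy : ∀ i, y i ≤ 1) {s : ℝ} (hs0 : 0 ≤ s)
    (hs1 : s ≤ 1) {z : X → ℝ} (hz : ∀ i, z i = (1 - s) * x i + s * y i) :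
    (1 - s) * multilinear f x + s * multilinear f y ≤ multilinear f z := by
  have hxz : ∀ i, x i ≤ z i := fun i => by rw [hz]; nlinarith [hxy i]
  have hzy : ∀ i, z i ≤ y i := fun i => by rw [hz]; nlinarith [hxy i]
  have h1 := multilinear_sub_le hf (fun i => (hx i).trans (hxz i)) hzy hy
  have h2 := le_multilinear_sub hf hx hxz fun i => (hzy i).trans (hy i)
  have e1 : ∑ j, (y j - z j) * partialDeriv j f z
      = (1 - s) * ∑ j, (y j - x j) * partialDeriv j f z := by
    rw [Finset.mul_sum]; exact Finset.sum_congr rfl fun j _ => by rw [hz]; ring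
  have e2 : ∑ j, (z j - x j) * partialDeriv j f z
      = s * ∑ j, (y j - x j) * partialDeriv j f z := by
    rw [Finset.mul_sum]; exact Finset.sum_congr rfl fun j _ => by rw [hz]; ring
  rw [e1] at h1
  rw [e2] at h2
  nlinarith [mul_le_mul_of_nonneg_left h1 hs0, mul_le_mul_of_nonneg_left h2 (sub_nonneg.2 hs1)]

/-- The multilinear extension of a submodular function is convex along `e_i - e_j`. -/
theorem multilinear_add_smul_ge {f : Finset X → ℝ} (hf : IsSubmodular f) {y : X → ℝ}
    (hy : ∀ i, 0 ≤ y i ∧ y i ≤ 1) (s : ℝ) {i j : X} (hij : i ≠ j) :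
    multilinear f y + s * (partialDeriv i f y - partialDeriv j f y) ≤
      multilinear f (y + s • (basisVec i - basisVec j)) := by
  have e : y + s • (basisVec i - basisVec j) =
      Function.update (Function.update y i (y i + s)) j (y j - s) := by
    ext k
    by_cases hkj : k = j
    · subst hkj; simp [basisVec, hij.symm, sub_eq_add_neg]
    · by_cases hki : k = i
      · subst hki; simp [basisVec, hij]
      · simp [basisVec, hki, hkj]
  rw [e, multilinear_update, multilinear_update, Function.update_of_ne hij.symm]
  have h2 : partialDeriv j f (Function.update y i (y i + s)) =
      partialDeriv j f y + s * partialDeriv i (discreteDeriv j f) y := by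
    rw [partialDeriv, multilinear_update]; simp only [partialDeriv]; ring
  rw [h2]
  -- The expansion is exact: the only second-order term is `-s²` times the mixed partial derivative,
  -- hence nonnegative.
  nlinarith [mul_nonneg (mul_self_nonneg s)
    (neg_nonneg.2 (partialDeriv_discreteDeriv_nonpos hf hy i j))]

/-! ### Rank function, tight sets and moves in the base polyhedron. -/

theorem cast_rank (M : Matroid X) (A : Finset X) :
    (((M.eRk (A : Set X)).toNat : ℕ) : ℕ∞) = M.eRk (A : Set X) :=
  ENat.natCast_toNat (ne_top_of_le_ne_top (by simp) (M.eRk_le_encard (A : Set X)))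

theorem rank_submodular (M : Matroid X) : IsSubmodular (rank M) := by
  intro S T
  have h := M.eRk_inter_add_eRk_union_le (S : Set X) T
  rw [← Finset.coe_inter, ← Finset.coe_union, ← cast_rank M (S ∩ T),
    ← cast_rank M (S ∪ T), ← cast_rank M S, ← cast_rank M T, add_comm] at h
  unfold rank
  exact_mod_cast h

theorem rank_le_card (M : Matroid X) (A : Finset X) : rank M A ≤ A.card := by
  have h := M.eRk_le_encard (A : Set X)
  rw [← cast_rank, Set.encard_coe_eq_coe_finsetCard] at h
  unfold rank
  exact_mod_cast h

theorem rank_mono (M : Matroid X) {A B : Finset X} (h : A ⊆ B) : rank M A ≤ rank M B := by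
  have h := M.eRk_mono (Finset.coe_subset.2 h)
  rw [← cast_rank M A, ← cast_rank M B] at h
  unfold rank
  exact_mod_cast h

theorem indep_iff_rank (M : Matroid X) (A : Finset X) :
    M.Indep (A : Set X) ↔ rank M A = A.card := by
  rw [Matroid.indep_iff_eRk_eq_encard_of_finite A.finite_toSet, ← cast_rank,
    Set.encard_coe_eq_coe_finsetCard]
  unfold rank
  exact ⟨fun h => by exact_mod_cast h, fun h => by exact_mod_cast h⟩

theorem rank_univ_eq (M : Matroid X) {B : Finset X} (hB : M.IsBase (B : Set X)) :
    rank M Finset.univ = B.card := by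
  rw [← (indep_iff_rank M B).1 hB.indep]
  simp only [rank, Finset.coe_univ, M.eRk_univ_eq, hB.eRk_eq_eRank]

theorem isBase_iff_rank (M : Matroid X) (B : Finset X) :
    M.IsBase (B : Set X) ↔ rank M B = B.card ∧ rank M Finset.univ = B.card := by
  refine ⟨fun h => ⟨(indep_iff_rank M B).1 h.indep, rank_univ_eq M h⟩, fun ⟨h1, h2⟩ => ?_⟩
  have hI := (indep_iff_rank M B).2 h1
  obtain ⟨B', hB', hBB'⟩ := hI.exists_isBase_superset
  have hc := rank_univ_eq M (B := B'.toFinite.toFinset) (by simpa using hB')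
  have hsub : B ⊆ B'.toFinite.toFinset := by
    intro k hk
    simpa using hBB' hk
  have := Finset.eq_of_subset_of_card_le hsub (by
    rw [h2] at hc
    exact_mod_cast hc.ge)
  rw [this]
  simpa using hB'

theorem exists_finset_isBase (M : Matroid X) : ∃ B : Finset X, M.IsBase (B : Set X) := by
  obtain ⟨B, hB⟩ := M.exists_isBase
  exact ⟨B.toFinite.toFinset, by simpa using hB⟩

/-- The polyhedral description of the base polytope. -/
structure MemBasePolyhedron (M : Matroid X) (y : X → ℝ) : Prop where
  nonneg : ∀ i, 0 ≤ y i
  slack_nonneg : ∀ A, 0 ≤ slack M y A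
  slack_univ : slack M y Finset.univ = 0

theorem MemBasePolyhedron.le_one {M : Matroid X} {y : X → ℝ} (hy : MemBasePolyhedron M y) (i : X) :
    y i ≤ 1 := by
  have h1 := hy.slack_nonneg {i}
  have h2 := rank_le_card M {i}
  simp [slack] at h1 h2
  linarith

theorem slack_submodular (M : Matroid X) (y : X → ℝ) : IsSubmodular (slack M y) := by
  intro S T
  have h := Finset.sum_union_inter (s₁ := S) (s₂ := T) (f := y)
  have := rank_submodular M S T
  simp only [slack]
  linarith

/-- Uncrossing: the slack is submodular and nonnegative, so two zeros force zeros at union and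
intersection. -/
theorem MemBasePolyhedron.slack_inter {M : Matroid X} {y : X → ℝ} (hy : MemBasePolyhedron M y)
    {S T : Finset X} (hS : slack M y S = 0) (hT : slack M y T = 0) : slack M y (S ∩ T) = 0 := by
  linarith [slack_submodular M y S T, hy.slack_nonneg (S ∪ T), hy.slack_nonneg (S ∩ T)]

theorem sum_add_smul (y : X → ℝ) (s : ℝ) (i j : X) (A : Finset X) :
    ∑ k ∈ A, (y + s • (basisVec i - basisVec j)) k =
      ∑ k ∈ A, y k + s * ((if i ∈ A then 1 else 0) - if j ∈ A then 1 else 0) := by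
  have h : ∀ i : X, ∑ k ∈ A, basisVec i k = if i ∈ A then (1 : ℝ) else 0 := fun i => by
    simp [basisVec, Pi.single_apply]
  simp [Finset.sum_add_distrib, ← Finset.mul_sum, h]

theorem slack_add_smul (M : Matroid X) (y : X → ℝ) (s : ℝ) (i j : X) (A : Finset X) :
    slack M (y + s • (basisVec i - basisVec j)) A =
      slack M y A - s * ((if i ∈ A then 1 else 0) - if j ∈ A then 1 else 0) := by
  rw [slack, sum_add_smul, slack]
  ring

theorem add_smul_apply_left (y : X → ℝ) (s : ℝ) {i j : X} (hij : i ≠ j) :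
    (y + s • (basisVec i - basisVec j)) i = y i + s := by
  simp [basisVec, hij]

theorem add_smul_apply_right (y : X → ℝ) (s : ℝ) {i j : X} (hij : i ≠ j) :
    (y + s • (basisVec i - basisVec j)) j = y j - s := by
  simp [basisVec, hij.symm, sub_eq_add_neg]

theorem add_smul_apply_of_ne (y : X → ℝ) (s : ℝ) {i j k : X} (hi : k ≠ i) (hj : k ≠ j) :
    (y + s • (basisVec i - basisVec j)) k = y k := by
  simp [basisVec, hi, hj]

/-- For `s ≥ 0` the move lowers only the coordinate `j` and the slacks of the sets that contain `i`
but not `j`. -/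
theorem MemBasePolyhedron.add_smul {M : Matroid X} {y : X → ℝ} (hy : MemBasePolyhedron M y)
    {i j : X} (hij : i ≠ j) {s : ℝ} (hs : 0 ≤ s) (hsj : s ≤ y j)
    (h : ∀ A : Finset X, i ∈ A → j ∉ A → s ≤ slack M y A) :
    MemBasePolyhedron M (y + s • (basisVec i - basisVec j)) where
  nonneg k := by
    by_cases hkj : k = j
    · subst hkj; rw [add_smul_apply_right _ _ hij]; linarith
    · by_cases hki : k = i
      · subst hki; rw [add_smul_apply_left _ _ hij]; linarith [hy.nonneg k]
      · rw [add_smul_apply_of_ne _ _ hki hkj]; exact hy.nonneg k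
  slack_nonneg A := by
    rw [slack_add_smul]
    have := hy.slack_nonneg A
    by_cases hi : i ∈ A <;> by_cases hj : j ∈ A <;> simp [hi, hj]
    · exact this
    · exact h A hi hj
    · linarith
    · exact this
  slack_univ := by simp [slack_add_smul, hy.slack_univ]

theorem HitConstraint.spec {M : Matroid X} {y y' : X → ℝ} {i j : X} {A : Finset X}
    (h : HitConstraint M y i j y' A) (hy : MemBasePolyhedron M y) (hij : i ≠ j) :
    MemBasePolyhedron M y' ∧
      (∃ s : ℝ, 0 ≤ s ∧ y' = y + s • (basisVec i - basisVec j)) ∧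
      ((i ∈ A ∧ j ∉ A ∧ slack M y' A = 0) ∨ (A = {j} ∧ y' j = 0)) := by
  cases h with
  | tight _ hA hle =>
    have h0 := hy.slack_nonneg A
    refine ⟨hy.add_smul hij h0 hle hA.2.2, ⟨slack M y A, h0, rfl⟩, Or.inl ⟨hA.1, hA.2.1, ?_⟩⟩
    simp [slack_add_smul, hA.1, hA.2.1]
  | zero A hA hlt =>
    refine ⟨hy.add_smul hij (hy.nonneg j) le_rfl fun A' h1 h2 => hlt.le.trans (hA.2.2 A' h1 h2),
      ⟨y j, hy.nonneg j, rfl⟩, Or.inr ⟨rfl, ?_⟩⟩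
    rw [add_smul_apply_right _ _ hij, sub_self]

theorem exists_hitConstraint (M : Matroid X) (y : X → ℝ) {i j : X} (hij : i ≠ j) :
    ∃ y' A, HitConstraint M y i j y' A := by
  obtain ⟨A, hA, hmin⟩ := Finset.exists_min_image
    (Finset.univ.filter fun A : Finset X => i ∈ A ∧ j ∉ A) (slack M y)
    ⟨{i}, by simp [hij.symm]⟩
  have hA' : IsTightest M y i j A :=
    ⟨(Finset.mem_filter.1 hA).2.1, (Finset.mem_filter.1 hA).2.2, fun A' h1 h2 =>
      hmin A' (by simp [h1, h2])⟩
  rcases le_or_gt (slack M y A) (y j) with h | h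
  · exact ⟨_, _, .tight A hA' h⟩
  · exact ⟨_, _, .zero A hA' h⟩

theorem isIntegerValued_rank (M : Matroid X) (A : Finset X) : IsIntegerValued (rank M A) :=
  ⟨((M.eRk (A : Set X)).toNat : ℤ), by simp [rank]⟩

theorem IsIntegerValued.add {a b : ℝ} (ha : IsIntegerValued a) (hb : IsIntegerValued b) :
    IsIntegerValued (a + b) := by
  obtain ⟨m, rfl⟩ := ha
  obtain ⟨n, rfl⟩ := hb
  exact ⟨m + n, by push_cast; rfl⟩

theorem IsIntegerValued.sub {a b : ℝ} (ha : IsIntegerValued a) (hb : IsIntegerValued b) :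
    IsIntegerValued (a - b) := by
  obtain ⟨m, rfl⟩ := ha
  obtain ⟨n, rfl⟩ := hb
  exact ⟨m - n, by push_cast; rfl⟩

theorem IsIntegerValued.sum {x : X → ℝ} {A : Finset X} (h : ∀ i ∈ A, IsIntegerValued (x i)) :
    IsIntegerValued (∑ i ∈ A, x i) := by
  induction A using Finset.induction_on with
  | empty => exact ⟨0, by simp⟩
  | insert a s ha ih =>
    rw [Finset.sum_insert ha]
    exact (h a (by simp)).add (ih fun i hi => h i (by simp [hi]))

/-- A tight set with a fractional element contains a second one. -/
theorem exists_ne_fractional {M : Matroid X} {y : X → ℝ} {T : Finset X} (hT : slack M y T = 0)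
    {i : X} (hi : i ∈ T) (hfi : ¬ IsIntegerValued (y i)) :
    ∃ j ∈ T, i ≠ j ∧ ¬ IsIntegerValued (y j) := by
  by_contra! h
  apply hfi
  have h1 : IsIntegerValued (∑ k ∈ T.erase i, y k) := IsIntegerValued.sum fun k hk =>
    h k (Finset.mem_of_mem_erase hk) (Finset.ne_of_mem_erase hk).symm
  have h2 : y i = rank M T - ∑ k ∈ T.erase i, y k := by
    have := Finset.add_sum_erase T y hi
    rw [slack] at hT
    linarith
  rw [h2]
  exact (isIntegerValued_rank M T).sub h1

open Classical in
-- Coordinates lie in `[0, 1]`, so `y` is the indicator of some `B`; the slack of `B` gives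
-- independence and the zero slack of the ground set gives the right cardinality.
theorem MemBasePolyhedron.isBase_of_integral {M : Matroid X} {y : X → ℝ}
    (hy : MemBasePolyhedron M y) (hint : ∀ i, IsIntegerValued (y i)) :
    M.IsBase ((Finset.univ.filter fun i => y i = 1 : Finset X) : Set X) ∧
      y = indicatorVec (Finset.univ.filter fun i => y i = 1) := by
  set B : Finset X := Finset.univ.filter fun i => y i = 1 with hB
  have hyB : y = indicatorVec B := by
    ext i
    obtain ⟨n, hn⟩ := hint i
    have h0 := hy.nonneg i
    have h1 := hy.le_one i
    rw [hn] at h0 h1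
    have h0' : (0 : ℤ) ≤ n := by exact_mod_cast h0
    have h1' : n ≤ (1 : ℤ) := by exact_mod_cast h1
    obtain rfl | rfl : n = 0 ∨ n = 1 := by omega
    · simp [indicatorVec, hB, hn]
    · simp [indicatorVec, hB, hn]
  refine ⟨(isBase_iff_rank M B).2 ⟨?_, ?_⟩, hyB⟩
  · refine (rank_le_card M B).antisymm ?_
    have h := hy.slack_nonneg B
    rw [slack, hyB] at h
    simpa [indicatorVec] using h
  · have h := hy.slack_univ
    rw [slack, hyB] at h
    simp [indicatorVec] at h
    linarith

theorem indicatorVec_memBasePolyhedron {M : Matroid X} {B : Finset X} (hB : M.IsBase (B : Set X)) :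
    MemBasePolyhedron M (indicatorVec B) where
  nonneg i := by unfold indicatorVec; split_ifs <;> norm_num
  slack_nonneg A := by
    have h1 := (indep_iff_rank M (A ∩ B)).1 (hB.indep.subset (by simp))
    have h2 := rank_mono M (Finset.inter_subset_left (s₁ := A) (s₂ := B))
    simp [slack, indicatorVec]
    linarith
  slack_univ := by simp [slack, indicatorVec, rank_univ_eq M hB]

theorem slack_combo (M : Matroid X) (x y : X → ℝ) {a b : ℝ} (hab : a + b = 1) (A : Finset X) :
    slack M (a • x + b • y) A = a * slack M x A + b * slack M y A := by
  simp only [slack, Pi.add_apply, Pi.smul_apply, smul_eq_mul, Finset.sum_add_distrib,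
    ← Finset.mul_sum]
  linear_combination (-rank M A) * hab

theorem memBasePolyhedron_of_mem_basePolytope {M : Matroid X} {x : X → ℝ}
    (hx : x ∈ basePolytope M) : MemBasePolyhedron M x := by
  have hconv : Convex ℝ {x | MemBasePolyhedron M x} := by
    intro x hx y hy a b ha hb hab
    refine ⟨fun i => ?_, fun A => ?_, ?_⟩
    · exact add_nonneg (mul_nonneg ha (hx.nonneg i)) (mul_nonneg hb (hy.nonneg i))
    · rw [slack_combo M x y hab]
      exact add_nonneg (mul_nonneg ha (hx.slack_nonneg A)) (mul_nonneg hb (hy.slack_nonneg A))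
    · rw [slack_combo M x y hab, hx.slack_univ, hy.slack_univ]
      simp
  refine convexHull_min ?_ hconv hx
  rintro _ ⟨B, hB, rfl⟩
  exact indicatorVec_memBasePolyhedron hB

/-- The points of the base polytope are the convex combinations of bases. -/
theorem mem_basePolytope_iff (M : Matroid X) (x : X → ℝ) :
    x ∈ basePolytope M ↔ ∃ β : Finset X → ℝ, (∀ B, 0 ≤ β B) ∧
      (∀ B, β B ≠ 0 → M.IsBase (B : Set X)) ∧ ∑ B, β B = 1 ∧
      ∀ k, x k = ∑ B, β B * indicatorVec B k := by
  constructor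
  · intro hx
    have hconv : Convex ℝ {x : X → ℝ | ∃ β : Finset X → ℝ, (∀ B, 0 ≤ β B) ∧
        (∀ B, β B ≠ 0 → M.IsBase (B : Set X)) ∧ ∑ B, β B = 1 ∧
        ∀ k, x k = ∑ B, β B * indicatorVec B k} := by
      rintro x ⟨β, h1, h2, h3, h4⟩ y ⟨γ, h1', h2', h3', h4'⟩ a b ha hb hab
      refine ⟨fun B => a * β B + b * γ B, fun B => ?_, fun B hB => ?_, ?_, fun k => ?_⟩
      · exact add_nonneg (mul_nonneg ha (h1 B)) (mul_nonneg hb (h1' B))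
      · by_contra h
        apply hB
        have e1 : β B = 0 := not_not.1 (mt (h2 B) h)
        have e2 : γ B = 0 := not_not.1 (mt (h2' B) h)
        simp [e1, e2]
      · rw [Finset.sum_add_distrib, ← Finset.mul_sum, ← Finset.mul_sum, h3, h3']
        linarith
      · simp only [Pi.add_apply, Pi.smul_apply, smul_eq_mul, h4, h4', add_mul,
          Finset.sum_add_distrib, Finset.mul_sum, mul_assoc]
    refine convexHull_min ?_ hconv hx
    rintro _ ⟨B, hB, rfl⟩
    refine ⟨Pi.single B 1, fun B' => ?_, fun B' hB' => ?_, ?_, fun k => ?_⟩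
    · rw [Pi.single_apply]; split_ifs <;> norm_num
    · rw [Pi.single_apply] at hB'
      obtain rfl : B' = B := by by_contra h; simp [h] at hB'
      exact hB
    · simp
    · simp [Pi.single_apply]
  · rintro ⟨β, h1, h2, h3, h4⟩
    have e : x = ∑ B ∈ Finset.univ.filter (fun B => β B ≠ 0), β B • indicatorVec B := by
      ext k
      rw [h4, Finset.sum_apply, Finset.sum_filter]
      refine Finset.sum_congr rfl fun B _ => ?_
      by_cases h : β B = 0 <;> simp [h]
    rw [e]
    refine (convex_convexHull ℝ _).sum_mem (fun B _ => h1 B) ?_ fun B hB => ?_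
    · rw [← h3, Finset.sum_filter_ne_zero]
    · exact subset_convexHull ℝ _ ⟨B, h2 B (Finset.mem_filter.1 hB).2, rfl⟩

/-! ### Pipage rounding: invariant, termination and progress. -/

/-- The invariant of the rounding phase. -/
def RoundInvariant (M : Matroid X) (y : X → ℝ) (T : Finset X) : Prop :=
  MemBasePolyhedron M y ∧ (slack M y T = 0 ∨ ∀ i ∈ T, IsIntegerValued (y i))

open Classical in
/-- The set of fractional coordinates. -/
noncomputable def fractionalSet (y : X → ℝ) : Finset X :=
  Finset.univ.filter fun i => ¬ IsIntegerValued (y i)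

theorem mem_fractionalSet {y : X → ℝ} {i : X} :
    i ∈ fractionalSet y ↔ ¬ IsIntegerValued (y i) := by
  simp [fractionalSet]

open Classical in
/-- A quantity that decreases in each step of the rounding phase. -/
noncomputable def roundMeasure (y : X → ℝ) (T : Finset X) : ℕ :=
  -- With `n = |X|`, the other terms are at most `2n + 1`, so losing a fractional coordinate
  -- outweighs them. The term `n + 1`, released by a restart, pays for resetting `T` to all of `X`.
  (fractionalSet y).card * (2 * (Fintype.card X + 1)) +
    ((if ∃ i ∈ T, ¬ IsIntegerValued (y i) then 0 else Fintype.card X + 1) + T.card)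

theorem roundMeasure_le (y : X → ℝ) (T : Finset X) :
    roundMeasure y T ≤
      Fintype.card X * (2 * (Fintype.card X + 1)) + (Fintype.card X + 1 + Fintype.card X) := by
  unfold roundMeasure
  gcongr
  · exact Finset.card_le_univ _
  · split_ifs <;> simp
  · exact Finset.card_le_univ _

theorem roundMeasure_lt_of_card_lt {y y' : X → ℝ} {T T' : Finset X}
    (h : (fractionalSet y').card < (fractionalSet y).card) :
    roundMeasure y' T' < roundMeasure y T := by
  unfold roundMeasure
  have h1 := Finset.card_le_univ T'
  have h2 : ((fractionalSet y').card + 1) * (2 * (Fintype.card X + 1)) ≤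
    (fractionalSet y).card * (2 * (Fintype.card X + 1)) := Nat.mul_le_mul_right _ h
  split_ifs <;> linarith

/-- Only the fractional coordinates `i`, `j` change, so no new ones appear. In the tight case `T`
stays tight since it contains both, and `T ∩ A` is tight by uncrossing; it keeps `i` and loses `j`,
so either `i` becomes integral or the set shrinks while still having a fractional element. In the
other case `j` becomes integral. -/
theorem hitConstraint_step {M : Matroid X} {y y' : X → ℝ} {i j : X} {T A : Finset X}
    (h : HitConstraint M y i j y' A) (hy : RoundInvariant M y T) (hij : i ≠ j)
    (hi : i ∈ T) (hj : j ∈ T) (hfi : ¬ IsIntegerValued (y i)) (hfj : ¬ IsIntegerValued (y j)) :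
    RoundInvariant M y' (T ∩ A) ∧ roundMeasure y' (T ∩ A) < roundMeasure y T := by
  obtain ⟨hP, ⟨s, -, hs⟩, hA⟩ := h.spec hy.1 hij
  have hsub : fractionalSet y' ⊆ fractionalSet y := by
    intro k hk
    rw [mem_fractionalSet] at hk ⊢
    by_cases hki : k = i
    · rwa [hki]
    · by_cases hkj : k = j
      · rwa [hkj]
      · rwa [hs, add_smul_apply_of_ne _ _ hki hkj] at hk
  have hlt : ∀ k, ¬ IsIntegerValued (y k) → IsIntegerValued (y' k) →
      roundMeasure y' (T ∩ A) < roundMeasure y T := fun k hk hk' =>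
    roundMeasure_lt_of_card_lt (Finset.card_lt_card ⟨hsub, fun hsub' =>
      mem_fractionalSet.1 (hsub' (mem_fractionalSet.2 hk)) hk'⟩)
  rcases hA with ⟨hiA, hjA, hA⟩ | ⟨rfl, hj0⟩
  · have hT : slack M y' T = 0 := by
      have hT := hy.2.resolve_right fun h => hfi (h i hi)
      rw [hs, slack_add_smul, hT]
      simp [hi, hj]
    refine ⟨⟨hP, Or.inl (hP.slack_inter hT hA)⟩, ?_⟩
    by_cases hi' : IsIntegerValued (y' i)
    · exact hlt i hfi hi'
    · have h1 : ∃ k ∈ T ∩ A, ¬ IsIntegerValued (y' k) := ⟨i, by simp [hi, hiA], hi'⟩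
      have h2 : ∃ k ∈ T, ¬ IsIntegerValued (y k) := ⟨i, hi, hfi⟩
      have h3 : (T ∩ A).card < T.card :=
        Finset.card_lt_card ⟨Finset.inter_subset_left, fun h =>
          hjA (Finset.mem_inter.1 (h hj)).2⟩
      have h4 := Nat.mul_le_mul_right (2 * (Fintype.card X + 1)) (Finset.card_le_card hsub)
      rw [roundMeasure, roundMeasure, if_pos h1, if_pos h2]
      omega
  · have h0 : IsIntegerValued (y' j) := ⟨0, by simp [hj0]⟩
    refine ⟨⟨hP, Or.inr fun k hk => ?_⟩, hlt j hfj h0⟩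
    obtain rfl : k = j := by simpa using (Finset.mem_inter.1 hk).2
    exact h0

/-- The invariant of the states that the algorithm can reach from the rounding phase. -/
def RoundStateInvariant (M : Matroid X) : State X → Prop
  | .round y T => RoundInvariant M y T
  | .done B => M.IsBase (B : Set X)
  | _ => False

/-- The termination measure for the rounding phase. -/
noncomputable def roundStateMeasure : State X → ℕ
  | .round y T => roundMeasure y T + 1
  | _ => 0

theorem roundInvariant_univ {M : Matroid X} {y : X → ℝ} (hy : MemBasePolyhedron M y) :
    RoundInvariant M y Finset.univ :=
  ⟨hy, Or.inl hy.slack_univ⟩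

theorem round_step {M : Matroid X} {f : Finset X → ℝ} {t δ p : ℝ} {s s₁ s₂ : State X}
    (h : Step M f t δ s p s₁ s₂) (hs : RoundStateInvariant M s) :
    (RoundStateInvariant M s₁ ∧ RoundStateInvariant M s₂) ∧
      roundStateMeasure s₁ < roundStateMeasure s ∧ roundStateMeasure s₂ < roundStateMeasure s := by
  cases h with
  | start => exact hs.elim
  | improve => exact hs.elim
  | finish => exact hs.elim
  | pipage y T i j hij hi hj hfi hfj yplus yminus Aplus Aminus hplus hminus p =>
    have h1 := hitConstraint_step hplus hs hij hi hj hfi hfj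
    have h2 := hitConstraint_step hminus hs hij.symm hj hi hfj hfi
    exact ⟨⟨h2.1, h1.1⟩, Nat.succ_lt_succ h2.2, Nat.succ_lt_succ h1.2⟩
  | restart y T hT hy =>
    have h1 : RoundInvariant M y Finset.univ := roundInvariant_univ hs.1
    have h2 : roundMeasure y Finset.univ < roundMeasure y T := by
      have h3 : ¬ ∃ i ∈ T, ¬ IsIntegerValued (y i) := by push Not; exact hT
      rw [roundMeasure, roundMeasure, if_neg h3, if_pos (by simpa using hy), Finset.card_univ]
      omega
    exact ⟨⟨h1, h1⟩, Nat.succ_lt_succ h2, Nat.succ_lt_succ h2⟩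
  | output y T hy =>
    have h1 := (hs.1.isBase_of_integral hy).1
    exact ⟨⟨h1, h1⟩, Nat.succ_pos _, Nat.succ_pos _⟩

theorem Step.prob_mem {M : Matroid X} {f : Finset X → ℝ} {t δ p : ℝ} {s s₁ s₂ : State X}
    (h : Step M f t δ s p s₁ s₂) : 0 ≤ p ∧ p ≤ 1 := by
  cases h <;> first | exact ⟨zero_le_one, le_rfl⟩ | exact ⟨by assumption, by assumption⟩

theorem norm_smul_basisVec_sub_pos {i j : X} (hij : i ≠ j) :
    0 < ‖(basisVec i - basisVec j : X → ℝ)‖ := by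
  rw [norm_pos_iff]
  intro h
  have := congrFun h i
  simp [basisVec, hij] at this

/-- The probabilities are such that the rounding step is a martingale. -/
theorem hitConstraint_pair {M : Matroid X} {y yplus yminus : X → ℝ} {i j : X}
    {Aplus Aminus : Finset X} (hy : MemBasePolyhedron M y) (hij : i ≠ j)
    (hplus : HitConstraint M y i j yplus Aplus) (hminus : HitConstraint M y j i yminus Aminus) :
    ∃ a b : ℝ, 0 ≤ a ∧ 0 ≤ b ∧ yplus = y + a • (basisVec i - basisVec j) ∧
      yminus = y + (-b) • (basisVec i - basisVec j) ∧
      -- The product form also covers `a = b = 0`, where every `p` is allowed.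
      ∀ p : ℝ, p * ‖yplus - yminus‖ = ‖yplus - y‖ ↔ p * (a + b) = a := by
  obtain ⟨-, ⟨a, ha, rfl⟩, -⟩ := hplus.spec hy hij
  obtain ⟨-, ⟨b, hb, rfl⟩, -⟩ := hminus.spec hy hij.symm
  refine ⟨a, b, ha, hb, rfl, ?_, fun p => ?_⟩
  · module
  · have e1 : (y + a • (basisVec i - basisVec j)) - (y + b • (basisVec j - basisVec i)) =
        (a + b) • (basisVec i - basisVec j : X → ℝ) := by module
    have e2 : (y + a • (basisVec i - basisVec j)) - y =
        a • (basisVec i - basisVec j : X → ℝ) := by module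
    rw [e1, e2, norm_smul, norm_smul, Real.norm_of_nonneg ha,
      Real.norm_of_nonneg (add_nonneg ha hb), ← mul_assoc, mul_left_inj' (norm_smul_basisVec_sub_pos hij).ne']

/-- A tight `T` has an integral coordinate sum, so it cannot contain exactly one fractional element:
a pair to round always exists. -/
theorem round_progress {M : Matroid X} (f : Finset X → ℝ) (t δ : ℝ) {s : State X}
    (hs : RoundStateInvariant M s) :
    (∃ B, s = .done B) ∨ ∃ p s₁ s₂, Step M f t δ s p s₁ s₂ := by
  cases s with
  | start => exact hs.elim
  | search => exact hs.elim
  | done B => exact Or.inl ⟨B, rfl⟩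
  | round y T =>
    right
    by_cases hint : ∀ i, IsIntegerValued (y i)
    · exact ⟨_, _, _, .output y T hint⟩
    by_cases hT : ∀ i ∈ T, IsIntegerValued (y i)
    · exact ⟨_, _, _, .restart y T hT (not_forall.1 hint)⟩
    have hslack := hs.2.resolve_right hT
    push Not at hT
    obtain ⟨i, hi, hfi⟩ := hT
    obtain ⟨j, hj, hij, hfj⟩ := exists_ne_fractional hslack hi hfi
    obtain ⟨yp, Ap, hp⟩ := exists_hitConstraint M y hij
    obtain ⟨ym, Am, hm⟩ := exists_hitConstraint M y hij.symm
    obtain ⟨a, b, ha, hb, -, -, hiff⟩ := hitConstraint_pair hs.1 hij hp hm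
    obtain ⟨p, hp0, hp1, hpab⟩ : ∃ p : ℝ, 0 ≤ p ∧ p ≤ 1 ∧ p * (a + b) = a := by
      rcases (add_nonneg ha hb).eq_or_lt with h | h
      · exact ⟨0, le_rfl, zero_le_one, by linarith⟩
      · exact ⟨a / (a + b), by positivity, (div_le_one h).2 (by linarith),
          div_mul_cancel₀ _ h.ne'⟩
    exact ⟨_, _, _, .pipage y T i j hij hi hj hfi hfj yp ym Ap Am hp hm p hp0 hp1 ((hiff p).2 hpab)⟩

/-! ### Distribution of the output and martingale bounds. -/

theorem exists_returns_of_measure {M : Matroid X} {f : Finset X → ℝ} {t δ : ℝ}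
    (I : State X → Prop) (m : State X → ℕ)
    (hstep : ∀ {p s s₁ s₂}, Step M f t δ s p s₁ s₂ → I s →
      (I s₁ ∧ I s₂) ∧ m s₁ < m s ∧ m s₂ < m s)
    (hprog : ∀ {s}, I s → (∃ B, s = .done B) ∨ ∃ p s₁ s₂, Step M f t δ s p s₁ s₂)
    (s : State X) (hs : I s) : ∃ μ, Returns M f t δ s μ := by
  induction hn : m s using Nat.strong_induction_on generalizing s with
  | _ n ih =>
    subst hn
    rcases hprog hs with ⟨B, rfl⟩ | ⟨p, s₁, s₂, h⟩
    · exact ⟨_, .done B⟩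
    · obtain ⟨⟨i1, i2⟩, m1, m2⟩ := hstep h hs
      obtain ⟨μ₁, h₁⟩ := ih _ m1 s₁ i1 rfl
      obtain ⟨μ₂, h₂⟩ := ih _ m2 s₂ i2 rfl
      exact ⟨_, .step s p s₁ s₂ μ₁ μ₂ h h₁ h₂⟩

/-- If `value s` is at most the mean value of the next state, then it is at most the mean value
of the result. -/
theorem Returns.bound {M : Matroid X} {f : Finset X → ℝ} {t δ : ℝ} (I : State X → Prop)
    (value : State X → ℝ)
    (hstep : ∀ {p s s₁ s₂}, Step M f t δ s p s₁ s₂ → I s →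
      (I s₁ ∧ I s₂) ∧ value s ≤ p * value s₁ + (1 - p) * value s₂)
    {s : State X} {μ : Finset X → ℝ} (h : Returns M f t δ s μ) (hs : I s) :
    value s ≤ ∑ B, μ B * value (.done B) := by
  induction h with
  | done B => simp [Pi.single_apply]
  | step s p s₁ s₂ μ₁ μ₂ h h₁ h₂ ih₁ ih₂ =>
    obtain ⟨⟨i1, i2⟩, hv⟩ := hstep h hs
    obtain ⟨hp0, hp1⟩ := h.prob_mem
    have e : ∑ B, (p • μ₁ + (1 - p) • μ₂) B * value (.done B) =
        p * ∑ B, μ₁ B * value (.done B) + (1 - p) * ∑ B, μ₂ B * value (.done B) := by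
      simp only [Pi.add_apply, Pi.smul_apply, smul_eq_mul, add_mul, Finset.sum_add_distrib,
        Finset.mul_sum, mul_assoc]
    rw [e]
    nlinarith [mul_le_mul_of_nonneg_left (ih₁ i1) hp0,
      mul_le_mul_of_nonneg_left (ih₂ i2) (sub_nonneg.2 hp1)]

theorem Returns.isProbability {M : Matroid X} {f : Finset X → ℝ} {t δ : ℝ}
    (I : State X → Prop)
    (hstep : ∀ {p s s₁ s₂}, Step M f t δ s p s₁ s₂ → I s → I s₁ ∧ I s₂)
    (hdone : ∀ {B}, I (.done B) → M.IsBase (B : Set X))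
    {s : State X} {μ : Finset X → ℝ} (h : Returns M f t δ s μ) (hs : I s) :
    (∀ B, 0 ≤ μ B) ∧ ∑ B, μ B = 1 ∧ ∀ B, μ B ≠ 0 → M.IsBase (B : Set X) := by
  induction h with
  | done B =>
    refine ⟨fun B' => ?_, by simp, fun B' hB' => ?_⟩
    · rw [Pi.single_apply]; split_ifs <;> norm_num
    · rw [Pi.single_apply] at hB'
      obtain rfl : B' = B := by by_contra h; simp [h] at hB'
      exact hdone hs
  | step s p s₁ s₂ μ₁ μ₂ h h₁ h₂ ih₁ ih₂ =>
    obtain ⟨i1, i2⟩ := hstep h hs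
    obtain ⟨hp0, hp1⟩ := h.prob_mem
    obtain ⟨a1, b1, c1⟩ := ih₁ i1
    obtain ⟨a2, b2, c2⟩ := ih₂ i2
    refine ⟨fun B => add_nonneg (mul_nonneg hp0 (a1 B)) (mul_nonneg (sub_nonneg.2 hp1) (a2 B)),
      ?_, fun B hB => ?_⟩
    · simp [Finset.sum_add_distrib, ← Finset.mul_sum, b1, b2]
    · by_contra h
      apply hB
      simp [not_not.1 (mt (c1 B) h), not_not.1 (mt (c2 B) h)]

/-- A function on points that does not exceed its mean over the outcomes of a rounding step. -/
def PipageConvex (M : Matroid X) (Φ : (X → ℝ) → ℝ) : Prop :=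
  ∀ ⦃y⦄, MemBasePolyhedron M y → ∀ ⦃i j : X⦄, i ≠ j → ∀ ⦃a b p : ℝ⦄, 0 ≤ p → p ≤ 1 →
    p * (a + b) = a → Φ y ≤ p * Φ (y + (-b) • (basisVec i - basisVec j)) +
      (1 - p) * Φ (y + a • (basisVec i - basisVec j))

/-- The value of a state in the rounding phase. -/
noncomputable def roundValue (Φ : (X → ℝ) → ℝ) : State X → ℝ
  | .round y _ => Φ y
  | .done B => Φ (indicatorVec B)
  | _ => 0

theorem roundValue_step {M : Matroid X} {f : Finset X → ℝ} {t δ p : ℝ} {s s₁ s₂ : State X}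
    {Φ : (X → ℝ) → ℝ} (hΦ : PipageConvex M Φ)
    (h : Step M f t δ s p s₁ s₂) (hs : RoundStateInvariant M s) :
    roundValue Φ s ≤ p * roundValue Φ s₁ + (1 - p) * roundValue Φ s₂ := by
  cases h with
  | start => exact hs.elim
  | improve => exact hs.elim
  | finish => exact hs.elim
  | pipage y T i j hij hi hj hfi hfj yplus yminus Aplus Aminus hplus hminus p hp0 hp1 hp =>
    obtain ⟨a, b, ha, hb, e1, e2, hiff⟩ := hitConstraint_pair hs.1 hij hplus hminus
    have := hΦ hs.1 hij hp0 hp1 ((hiff p).1 hp)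
    rw [← e1, ← e2] at this
    exact this
  | restart y T hT hy => simp [roundValue]
  | output y T hy => simp [roundValue, ← (hs.1.isBase_of_integral hy).2]

theorem returns_round_bound {M : Matroid X} {f : Finset X → ℝ} {t δ : ℝ} {Φ : (X → ℝ) → ℝ}
    (hΦ : PipageConvex M Φ) {s : State X} {μ : Finset X → ℝ} (h : Returns M f t δ s μ)
    (hs : RoundStateInvariant M s) : roundValue Φ s ≤ ∑ B, μ B * Φ (indicatorVec B) :=
  h.bound (RoundStateInvariant M) (roundValue Φ)
    (fun h hs => ⟨(round_step h hs).1, roundValue_step hΦ h hs⟩) hs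

/-- Coordinates are martingales, so equality holds; the factor `c` is there to be taken as `1` and
`-1`, which gives both inequalities for the mean. -/
theorem pipageConvex_smul_apply (M : Matroid X) (c : ℝ) (k : X) :
    PipageConvex M fun y => c * y k := by
  intro y _ i j _ a b p _ _ hp
  simp only [Pi.add_apply, Pi.smul_apply, smul_eq_mul]
  apply le_of_eq
  linear_combination c * ((basisVec i - basisVec j : X → ℝ) k) * hp

/-- Convexity bounds `F` below by its tangent along the line, and `p * (a + b) = a` makes the
first-order terms cancel in the mean. -/
theorem pipageConvex_multilinear (M : Matroid X) {f : Finset X → ℝ} (hf : IsSubmodular f) :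
    PipageConvex M (multilinear f) := by
  intro y hy i j hij a b p hp0 hp1 hp
  have hy' : ∀ i, 0 ≤ y i ∧ y i ≤ 1 := fun i => ⟨hy.nonneg i, hy.le_one i⟩
  have h1 := mul_le_mul_of_nonneg_left (multilinear_add_smul_ge hf hy' (-b) hij) hp0
  have h2 := mul_le_mul_of_nonneg_left (multilinear_add_smul_ge hf hy' a hij) (sub_nonneg.2 hp1)
  have h3 : (p * (a + b)) * (partialDeriv i f y - partialDeriv j f y) =
    a * (partialDeriv i f y - partialDeriv j f y) := by rw [hp]
  linarith

/-- For the hard inclusion, round `x`: the output is a random base whose indicator vector has mean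
`x`, which is a convex combination of bases. -/
theorem mem_basePolytope_iff_memBasePolyhedron (M : Matroid X) (x : X → ℝ) :
    x ∈ basePolytope M ↔ MemBasePolyhedron M x := by
  refine ⟨memBasePolyhedron_of_mem_basePolytope, fun hx => ?_⟩
  have hI : RoundStateInvariant M (.round x Finset.univ) := roundInvariant_univ hx
  -- The rounding phase does not depend on `f`, `t` or `δ`; the zeros are placeholders.
  obtain ⟨μ, hμ⟩ := exists_returns_of_measure (f := fun _ => 0) (t := 0) (δ := 0)
    (RoundStateInvariant M) roundStateMeasure round_step (round_progress _ _ _) _ hI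
  obtain ⟨h1, h2, h3⟩ := hμ.isProbability (RoundStateInvariant M)
    (fun h hs => (round_step h hs).1) id hI
  refine (mem_basePolytope_iff M x).2 ⟨μ, h1, h3, h2, fun k => ?_⟩
  have h4 := returns_round_bound (pipageConvex_smul_apply M 1 k) hμ hI
  have h5 := returns_round_bound (pipageConvex_smul_apply M (-1) k) hμ hI
  simp only [roundValue, one_mul, neg_mul, mul_neg, Finset.sum_neg_distrib] at h4 h5
  linarith

/-! ### Grid points and the starting point. -/

/-- The points all of whose coordinates are integer multiples of `δ`. -/
def IsGridPoint (δ : ℝ) (x : X → ℝ) : Prop := ∀ i, ∃ n : ℤ, x i = n * δ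

/-- The grid points in the box `[0, c]^X`. -/
def gridBox (X : Type*) (δ c : ℝ) : Set (X → ℝ) :=
  {x | IsGridPoint δ x ∧ ∀ i, 0 ≤ x i ∧ x i ≤ c}

theorem finite_gridBox {q : ℕ} (hq : 0 < q) (c : ℝ) :
    (gridBox X (1 / (q : ℝ)) c).Finite := by
  have hq' : (0 : ℝ) < q := by exact_mod_cast hq
  refine (Set.Finite.pi' (fun _ : X =>
    (Set.finite_Icc (0 : ℤ) ⌊q * c⌋).image fun n : ℤ => (n : ℝ) * (1 / (q : ℝ)))).subset ?_
  rintro x ⟨hx, hc⟩ i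
  obtain ⟨n, hn⟩ := hx i
  have hn' : (n : ℝ) = q * x i := by rw [hn]; field_simp
  refine ⟨n, ⟨?_, Int.le_floor.2 ?_⟩, hn.symm⟩
  · have : (0 : ℝ) ≤ n := by rw [hn']; exact mul_nonneg hq'.le (hc i).1
    exact_mod_cast this
  · rw [hn']; exact mul_le_mul_of_nonneg_left (hc i).2 hq'.le

/-- Two grid values that differ do so by at least the step of the grid. -/
theorem add_le_of_lt_of_grid {q : ℕ} (hq : 0 < q) {a b : ℝ}
    (ha : ∃ n : ℤ, a = n * (1 / (q : ℝ))) (hb : ∃ n : ℤ, b = n * (1 / (q : ℝ))) (hab : a < b) :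
    a + 1 / (q : ℝ) ≤ b := by
  obtain ⟨m, rfl⟩ := ha
  obtain ⟨n, rfl⟩ := hb
  have hq' : (0 : ℝ) < 1 / q := by positivity
  have h : (m : ℝ) < n := lt_of_mul_lt_mul_right hab hq'.le
  have h' : (m : ℝ) + 1 ≤ n := by exact_mod_cast h
  nlinarith

theorem grid_slack {q : ℕ} (hq : 0 < q) (M : Matroid X) {x : X → ℝ}
    (hx : IsGridPoint (1 / (q : ℝ)) x) (A : Finset X) :
    ∃ n : ℤ, slack M x A = n * (1 / (q : ℝ)) := by
  have hq' : (q : ℝ) ≠ 0 := by positivity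
  choose n hn using hx
  obtain ⟨m, hm⟩ := isIntegerValued_rank M A
  refine ⟨m * q - ∑ k ∈ A, n k, ?_⟩
  rw [slack, hm, Finset.sum_congr rfl fun k _ => hn k, ← Finset.sum_mul]
  push_cast
  field_simp

theorem IsGridPoint.add_smul {δ : ℝ} {x : X → ℝ} (hx : IsGridPoint δ x) (i j : X) :
    IsGridPoint δ (x + δ • (basisVec i - basisVec j)) := by
  intro k
  obtain ⟨n, hn⟩ := hx k
  refine ⟨n + (if k = i then 1 else 0) - (if k = j then 1 else 0), ?_⟩
  simp only [Pi.add_apply, Pi.smul_apply, Pi.sub_apply, smul_eq_mul, basisVec, Pi.single_apply, hn]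
  push_cast
  ring

/-- If the base polytope has a point in a box with grid side length,
then it has a grid point in this box. -/
theorem exists_gridPoint {M : Matroid X} {x : X → ℝ} (hx : MemBasePolyhedron M x) {r q : ℕ}
    (hq : 0 < q) (hxt : ∀ i, x i ≤ (r : ℝ) / q) :
    ∃ z, MemBasePolyhedron M z ∧ (∀ i, z i ≤ (r : ℝ) / q) ∧ IsGridPoint (1 / (q : ℝ)) z := by
  have hq' : (0 : ℝ) < 1 / q := by positivity
  have ht : ∃ n : ℤ, (r : ℝ) / q = n * (1 / (q : ℝ)) := ⟨r, by push_cast; ring⟩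
  -- Take a grid point of largest sum in the independence polytope cut by the box. The origin shows
  -- that there is one.
  obtain ⟨z, ⟨⟨hgrid, hbox⟩, hslack⟩, hmax⟩ := Set.exists_max_image
    {z : X → ℝ | z ∈ gridBox X (1 / (q : ℝ)) ((r : ℝ) / q) ∧
      ∀ A, 0 ≤ slack M z A} (fun z => ∑ i, z i)
    ((finite_gridBox hq _).subset fun z hz => hz.1)
    ⟨0, ⟨fun i => ⟨0, by simp⟩, fun i => ⟨le_rfl, by positivity⟩⟩, fun A => by
      simp [slack, rank]⟩
  -- Otherwise all slacks of sets containing `i` are at least `1/q`, and `z i` could be raised by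
  -- one grid step.
  have htight : ∀ i, z i < (r : ℝ) / q → ∃ A, i ∈ A ∧ slack M z A = 0 := by
    intro i hi
    by_contra! h
    have hsum : ∀ A : Finset X, ∑ k ∈ A, (z + (1 / (q : ℝ)) • basisVec i) k =
        ∑ k ∈ A, z k + if i ∈ A then 1 / (q : ℝ) else 0 := fun A => by
      simp [Finset.sum_add_distrib, basisVec, Pi.single_apply]
    have := hmax (z + (1 / (q : ℝ)) • basisVec i) ⟨⟨fun k => ?_, fun k => ?_⟩, fun A => ?_⟩
    · rw [hsum] at this
      simp only [Finset.mem_univ, if_true] at this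
      linarith
    · obtain ⟨n, hn⟩ := hgrid k
      refine ⟨n + if k = i then 1 else 0, ?_⟩
      simp only [Pi.add_apply, Pi.smul_apply, smul_eq_mul, basisVec, Pi.single_apply, hn]
      push_cast
      ring
    · by_cases hk : k = i
      · subst hk
        have := add_le_of_lt_of_grid hq (hgrid k) ht hi
        simp only [Pi.add_apply, Pi.smul_apply, smul_eq_mul, basisVec, Pi.single_eq_same, mul_one]
        exact ⟨by linarith [(hbox k).1], this⟩
      · simpa [basisVec, hk] using hbox k
    · rw [slack, hsum]
      have h0 := hslack A
      by_cases hiA : i ∈ A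
      · have := add_le_of_lt_of_grid hq ⟨0, by simp⟩ (grid_slack hq M hgrid A)
          (h0.lt_of_ne' (h A hiA))
        rw [slack] at this
        simp only [hiA, if_true]
        linarith
      · simpa [hiA, slack] using h0
  -- Tight sets are closed under union, so a largest one `D` contains all of them; outside `D` every
  -- coordinate is at the cap `r/q`.
  obtain ⟨D, hD, hDmax⟩ := Finset.exists_max_image
    (Finset.univ.filter fun A : Finset X => slack M z A = 0) Finset.card
    ⟨∅, Finset.mem_filter.2 ⟨Finset.mem_univ _, by simp [slack, rank]⟩⟩
  have hD0 : slack M z D = 0 := (Finset.mem_filter.1 hD).2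
  have hcompl : ∀ i ∈ Dᶜ, z i = (r : ℝ) / q := by
    intro i hi
    by_contra hne
    obtain ⟨A, hiA, hA⟩ := htight i ((hbox i).2.lt_of_ne hne)
    have hU : slack M z (D ∪ A) = 0 := by
      linarith [slack_submodular M z D A, hslack (D ∪ A), hslack (D ∩ A)]
    have h1 := hDmax (D ∪ A) (by simp [hU])
    have h2 := Finset.eq_of_subset_of_card_le Finset.subset_union_left h1
    rw [Finset.mem_compl, h2] at hi
    exact hi (Finset.mem_union_right _ hiA)
  refine ⟨z, ⟨fun i => (hbox i).1, hslack, le_antisymm ?_ (hslack _)⟩, fun i => (hbox i).2, hgrid⟩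
  -- On `D` the sum of `z` equals the rank, off `D` it is as large as the box allows, so its total
  -- is at least that of `x`, which is the rank of `X`.
  have h1 := Finset.sum_add_sum_compl D z
  have h2 := Finset.sum_add_sum_compl D x
  have h3 : ∑ i ∈ Dᶜ, x i ≤ ∑ i ∈ Dᶜ, z i :=
    Finset.sum_le_sum fun i hi => (hxt i).trans_eq (hcompl i hi).symm
  have h4 := hx.slack_nonneg D
  have h5 := hx.slack_univ
  rw [slack] at *
  linarith

/-- Dividing the packing weights by `ν` gives a point of the base polytope with coordinates at most
`1/ν = t`. -/
theorem exists_start {M : Matroid X} {ν t : ℝ} (hν : 1 ≤ ν)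
    (hpack : HasFractionalBasePacking M ν) (ht : t = 1 / ν) {r q : ℕ} (hq : 0 < q)
    (htrq : t = (r : ℝ) / q) :
    ∃ x ∈ boxedBasePolytope M t, IsGridPoint (1 / (q : ℝ)) x := by
  obtain ⟨α, h1, h2, h3, h4⟩ := hpack
  have hν0 : 0 < ν := by linarith
  have hx : (fun k => ∑ B, α B / ν * indicatorVec B k) ∈ basePolytope M := by
    refine (mem_basePolytope_iff M _).2 ⟨fun B => α B / ν, fun B => div_nonneg (h1 B) hν0.le,
      fun B hB => h2 B fun h => hB (by simp [h]), ?_, fun k => rfl⟩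
    rw [← Finset.sum_div, h4, div_self hν0.ne']
  obtain ⟨z, hz, hzt, hgrid⟩ := exists_gridPoint
    (memBasePolyhedron_of_mem_basePolytope hx) (r := r) hq fun i => by
      rw [← htrq, ht]
      have e : ∑ B, α B / ν * indicatorVec B i = (∑ B with i ∈ B, α B) / ν := by
        rw [Finset.sum_filter, Finset.sum_div]
        refine Finset.sum_congr rfl fun B _ => ?_
        by_cases h : i ∈ B <;> simp [indicatorVec, h]
      rw [e]
      exact div_le_div_of_nonneg_right (h3 i) hν0.le
  exact ⟨z, ⟨(mem_basePolytope_iff_memBasePolyhedron M z).2 hz, fun i =>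
    ⟨hz.nonneg i, htrq ▸ hzt i⟩⟩, hgrid⟩

/-! ### Exchange matchings and feasible steps. -/

/-- Basis exchange along a matching of `C \ B` into `B \ C`. -/
theorem exists_exchange_matching {M : Matroid X} {B C : Finset X} (hB : M.IsBase (B : Set X))
    (hC : M.IsBase (C : Set X)) :
    ∃ σ : {j // j ∈ C \ B} → X, Function.Injective σ ∧ ∀ j, σ j ∈ B \ C ∧
      M.IsBase ((insert j.1 (B.erase (σ j)) : Finset X) : Set X) := by
  classical
  let N : {j // j ∈ C \ B} → Finset X := fun j =>
    (B \ C).filter fun i => M.IsBase ((insert j.1 (B.erase i) : Finset X) : Set X)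
  suffices h : ∀ s : Finset {j // j ∈ C \ B}, s.card ≤ (s.biUnion N).card by
    obtain ⟨σ, hσ, hσN⟩ := (Finset.all_card_le_biUnion_card_iff_exists_injective N).1 h
    exact ⟨σ, hσ, fun j => Finset.mem_filter.1 (hσN j)⟩
  intro s
  by_contra! hlt
  have hNB : s.biUnion N ⊆ B \ C := Finset.biUnion_subset.2 fun j _ => Finset.filter_subset _ _
  -- If Hall's condition fails at `s`, then `I ⊆ B` is smaller than `J ⊆ C`, so some `j ∈ s`
  -- augments `I`. Completing `I + j` to a base inside `B + j` drops exactly one `i ∈ B`, outside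
  -- `I`. Then `i` is a neighbour of `j`, hence in `I`: a contradiction.
  set I := (B ∩ C) ∪ s.biUnion N with hI
  set J := (B ∩ C) ∪ s.map (Function.Embedding.subtype _) with hJ
  have hIB : I ⊆ B := Finset.union_subset Finset.inter_subset_left
    (hNB.trans Finset.sdiff_subset)
  have hJC : J ⊆ C := Finset.union_subset Finset.inter_subset_right fun k hk => by
    obtain ⟨j, -, rfl⟩ := Finset.mem_map.1 hk
    exact (Finset.mem_sdiff.1 j.2).1
  have hcard : I.card < J.card := by
    rw [hI, hJ, Finset.card_union_of_disjoint, Finset.card_union_of_disjoint, Finset.card_map]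
    · omega
    · refine Finset.disjoint_left.2 fun k hk hk' => ?_
      obtain ⟨j, -, rfl⟩ := Finset.mem_map.1 hk'
      exact (Finset.mem_sdiff.1 j.2).2 (Finset.mem_inter.1 hk).1
    · exact Finset.disjoint_left.2 fun k hk hk' =>
        (Finset.mem_sdiff.1 (hNB hk')).2 (Finset.mem_inter.1 hk).2
  obtain ⟨e, he, hins⟩ := (hB.indep.subset (Finset.coe_subset.2 hIB)).exists_insert_of_encard_lt
    (hC.indep.subset (Finset.coe_subset.2 hJC)) (by
      rw [Set.encard_coe_eq_coe_finsetCard, Set.encard_coe_eq_coe_finsetCard]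
      exact_mod_cast hcard)
  have heI : e ∉ I := fun h => he.2 (Finset.mem_coe.2 h)
  have heC : e ∈ C := hJC (Finset.mem_coe.1 he.1)
  have heB : e ∉ B := fun h => heI (Finset.mem_union_left _ (Finset.mem_inter.2 ⟨h, heC⟩))
  obtain ⟨j, hjs, rfl⟩ : ∃ j ∈ s, j.1 = e := by
    rcases Finset.mem_union.1 (Finset.mem_coe.1 he.1) with h | h
    · exact absurd (Finset.mem_inter.1 h).1 heB
    · obtain ⟨j, hj, h⟩ := Finset.mem_map.1 h
      exact ⟨j, hj, h⟩
  obtain ⟨B₁, hB₁, hIB₁, hB₁B⟩ := hins.exists_isBase_subset_union_isBase hB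
  obtain ⟨B', rfl⟩ : ∃ B' : Finset X, (B' : Set X) = B₁ := ⟨B₁.toFinite.toFinset, by simp⟩
  have hjB' : j.1 ∈ B' := by exact_mod_cast hIB₁ (Set.mem_insert _ _)
  have hIB' : I ⊆ B' := fun k hk => by
    exact_mod_cast hIB₁ (Set.mem_insert_of_mem _ (Finset.mem_coe.2 hk))
  have hB'B : B' ⊆ insert j.1 B := fun k hk => by
    rcases hB₁B (Finset.mem_coe.2 hk) with (h | h) | h
    · simp [h]
    · exact Finset.mem_insert_of_mem (hIB h)
    · exact Finset.mem_insert_of_mem h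
  have hBB' : B'.card = B.card := by
    have := (rank_univ_eq M hB₁).symm.trans (rank_univ_eq M hB)
    exact_mod_cast this
  obtain ⟨i, hi, hiB'⟩ : ∃ i ∈ B, i ∉ B' := by
    by_contra! h
    have := Finset.eq_of_subset_of_card_le h hBB'.le
    exact heB (this ▸ hjB')
  have hBi : B' = insert j.1 (B.erase i) := by
    refine Finset.eq_of_subset_of_card_le (fun k hk => ?_) ?_
    · have hki : k ≠ i := fun h => hiB' (h ▸ hk)
      have := hB'B hk
      simp only [Finset.mem_insert, Finset.mem_erase] at this ⊢
      tauto
    · have h1 := Finset.card_insert_le j.1 (B.erase i)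
      have h2 := Finset.card_erase_add_one hi
      omega
  have hiC : i ∉ C := fun h =>
    hiB' (hIB' (Finset.mem_union_left _ (Finset.mem_inter.2 ⟨hi, h⟩)))
  refine hiB' (hIB' (Finset.mem_union_right _ (Finset.mem_biUnion.2 ⟨j, hjs, ?_⟩)))
  exact Finset.mem_filter.2 ⟨Finset.mem_sdiff.2 ⟨hi, hiC⟩, hBi ▸ hB₁⟩

theorem slack_eq_sum {M : Matroid X} {x : X → ℝ} {β : Finset X → ℝ} (hβ1 : ∑ B, β B = 1)
    (hx : ∀ k, x k = ∑ B, β B * indicatorVec B k) (A : Finset X) :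
    slack M x A = ∑ B, β B * slack M (indicatorVec B) A := by
  simp only [slack, mul_sub, Finset.sum_sub_distrib, ← Finset.sum_mul, hβ1, one_mul]
  rw [Finset.sum_congr rfl fun k _ => hx k, Finset.sum_comm]
  simp only [Finset.mul_sum]

/-- If a base `B` occurs in `x`, then an exchange in `B` is a feasible step at `x`. -/
theorem exchange_mem_boxedBasePolytope {M : Matroid X} {x : X → ℝ} {β : Finset X → ℝ}
    (hβ0 : ∀ B, 0 ≤ β B) (hβb : ∀ B, β B ≠ 0 → M.IsBase (B : Set X)) (hβ1 : ∑ B, β B = 1)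
    (hx : ∀ k, x k = ∑ B, β B * indicatorVec B k) {t : ℝ} {r q : ℕ} (hq : 0 < q)
    (ht : t = (r : ℝ) / q) (hxb : x ∈ boxedBasePolytope M t) (hgrid : IsGridPoint (1 / (q : ℝ)) x)
    {B : Finset X} (hB : β B ≠ 0) {i j : X} (hi : i ∈ B) (hj : j ∉ B) (hjt : x j < t)
    (hex : M.IsBase ((insert j (B.erase i) : Finset X) : Set X)) :
    x + (1 / (q : ℝ)) • (basisVec j - basisVec i) ∈ boxedBasePolytope M t := by
  have hji : j ≠ i := fun h => hj (h ▸ hi)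
  have hq' : (0 : ℝ) < 1 / q := by positivity
  have hBpos : 0 < β B := (hβ0 B).lt_of_ne' hB
  have hP := (mem_basePolytope_iff_memBasePolyhedron M x).1 hxb.1
  have hind : ∀ (B : Finset X) k, 0 ≤ indicatorVec B k := fun B k => by
    unfold indicatorVec; split_ifs <;> norm_num
  have hzero : ∃ n : ℤ, (0 : ℝ) = n * (1 / (q : ℝ)) := ⟨0, by simp⟩
  have hxi : 1 / (q : ℝ) ≤ x i := by
    have h1 : 0 < x i := by
      have := Finset.single_le_sum (f := fun B => β B * indicatorVec B i)
        (fun B _ => mul_nonneg (hβ0 B) (hind B i)) (Finset.mem_univ B)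
      rw [← hx] at this
      simp only [indicatorVec, hi, if_true, mul_one] at this
      exact hBpos.trans_le this
    simpa using add_le_of_lt_of_grid hq hzero (hgrid i) h1
  have hP' := hP.add_smul hji hq'.le hxi fun A hjA hiA => by
    -- The slack of `A` at `x` averages those at the bases. At `B` it is at least `1`, since passing
    -- to `B - i + j` adds one element of `A` and the slack stays nonnegative. Positivity then means
    -- at least `1/q` on the grid.
    have h1 : 0 < slack M x A := by
      have h2 := Finset.single_le_sum (f := fun B => β B * slack M (indicatorVec B) A)
        (fun B _ => by
          by_cases h : β B = 0
          · simp [h]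
          · exact mul_nonneg (hβ0 B) ((indicatorVec_memBasePolyhedron (hβb B h)).slack_nonneg A))
        (Finset.mem_univ B)
      rw [← slack_eq_sum hβ1 hx] at h2
      refine (mul_pos hBpos ?_).trans_le h2
      have h3 := (indicatorVec_memBasePolyhedron hex).slack_nonneg A
      have h4 : A ∩ insert j (B.erase i) = insert j (A ∩ B) := by
        ext k
        simp only [Finset.mem_inter, Finset.mem_insert, Finset.mem_erase]
        by_cases hk : k = j
        · simp [hk, hjA]
        · by_cases hk' : k = i <;> simp [hk, hk', hiA, hji.symm]
      have h5 : (A ∩ insert j (B.erase i)).card = (A ∩ B).card + 1 := by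
        rw [h4, Finset.card_insert_of_notMem (by simp [hj])]
      simp only [slack, indicatorVec, Finset.sum_ite_mem, Finset.sum_const, h5, nsmul_eq_mul,
        mul_one] at h3 ⊢
      push_cast at h3
      linarith
    simpa using add_le_of_lt_of_grid hq hzero (grid_slack hq M hgrid A) h1
  refine ⟨(mem_basePolytope_iff_memBasePolyhedron M _).2 hP', fun k => ⟨hP'.nonneg k, ?_⟩⟩
  by_cases hkj : k = j
  · subst hkj
    rw [add_smul_apply_left _ _ hji]
    exact add_le_of_lt_of_grid hq (hgrid k) ⟨r, by rw [ht]; push_cast; ring⟩ hjt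
  · by_cases hki : k = i
    · subst hki
      rw [add_smul_apply_right _ _ hji]
      linarith [(hxb.2 k).2]
    · rw [add_smul_apply_of_ne _ _ hkj hki]
      exact (hxb.2 k).2

/-! ### The value of a local optimum. -/

/-- By convexity along `e_j - e_i`, a positive slope at `x` would make the step of full length `δ`
improving. -/
theorem partialDeriv_le_of_not_isImproving {M : Matroid X} {f : Finset X → ℝ}
    (hf : IsSubmodular f) {t δ : ℝ} (hδ : 0 < δ) {x : X → ℝ} (hx : ∀ i, 0 ≤ x i ∧ x i ≤ 1)
    {i j : X} (hij : i ≠ j)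
    (hmem : x + δ • (basisVec j - basisVec i) ∈ boxedBasePolytope M t)
    (h : ¬ IsImproving M f t δ x i j) : partialDeriv j f x ≤ partialDeriv i f x := by
  have h1 := not_lt.1 fun h' => h ⟨hmem, h'⟩
  have h2 := multilinear_add_smul_ge hf hx δ hij.symm
  by_contra! h3
  linarith [mul_pos hδ (sub_pos.2 h3)]

/-- Raising the coordinates in `K ⊆ C` to `1` and lowering coordinates outside `C`
by some amount changes the value of a local optimum in a controlled way. -/
theorem exists_lowering_of_matching {f : Finset X → ℝ} (hf : IsSubmodular f) {x : X → ℝ}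
    (hx01 : ∀ i, 0 ≤ x i ∧ x i ≤ 1) {β : Finset X → ℝ} (hβ0 : ∀ B, 0 ≤ β B)
    (hβ1 : ∑ B, β B = 1) (hx : ∀ k, x k = ∑ B, β B * indicatorVec B k) {K C : Finset X}
    (h : ∀ B, β B ≠ 0 → ∃ I ⊆ B \ C,
      ∑ j ∈ K \ B, partialDeriv j f x ≤ ∑ i ∈ I, partialDeriv i f x) :
    ∃ z : X → ℝ, (∀ i, 0 ≤ z i ∧ z i ≤ x i) ∧ (∀ i ∈ C, z i = x i) ∧
      multilinear f (K.piecewise 1 x) + multilinear f z ≤ 2 * multilinear f x := by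
  set w : X → ℝ := fun j => partialDeriv j f x with hw
  have h' : ∀ B, ∃ I ⊆ B \ C, β B * ∑ j ∈ K \ B, w j ≤ β B * ∑ i ∈ I, w i := fun B => by
    by_cases hB : β B = 0
    · exact ⟨∅, by simp, by simp [hB]⟩
    · obtain ⟨I, h1, h2⟩ := h B hB
      exact ⟨I, h1, mul_le_mul_of_nonneg_left h2 (hβ0 B)⟩
  choose I hI hIw using h'
  -- The average of the removed sets `I B ⊆ B \ C`; hence it lies below `x` and vanishes on `C`.
  set m : X → ℝ := fun k => ∑ B, β B * indicatorVec (I B) k with hm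
  have hind : ∀ (B : Finset X) k, 0 ≤ indicatorVec B k := fun B k => by
    unfold indicatorVec; split_ifs <;> norm_num
  have hm0 : ∀ k, 0 ≤ m k := fun k => Finset.sum_nonneg fun B _ => mul_nonneg (hβ0 B) (hind _ k)
  have hmx : ∀ k, m k ≤ x k := fun k => by
    rw [hx]
    refine Finset.sum_le_sum fun B _ => mul_le_mul_of_nonneg_left ?_ (hβ0 B)
    by_cases hk : k ∈ I B
    · simp [indicatorVec, hk, (Finset.mem_sdiff.1 (hI B hk)).1]
    · simpa [indicatorVec, hk] using hind B k
  have hmC : ∀ k ∈ C, m k = 0 := fun k hk => Finset.sum_eq_zero fun B _ => by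
    have : k ∉ I B := fun h => (Finset.mem_sdiff.1 (hI B h)).2 hk
    simp [indicatorVec, this]
  have hup := multilinear_sub_le hf (x := x) (y := K.piecewise 1 x) (fun i => (hx01 i).1)
    (fun i => by by_cases hi : i ∈ K <;> simp [hi, (hx01 i).2])
    (fun i => by by_cases hi : i ∈ K <;> simp [hi, (hx01 i).2])
  have hdown := le_multilinear_sub hf (x := fun k => x k - m k) (y := x)
    (fun i => sub_nonneg.2 (hmx i)) (fun i => sub_le_self _ (hm0 i)) (fun i => (hx01 i).2)
  -- This uses that `1 - x j` is the total weight of the bases avoiding `j`.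
  have e1 : ∑ j, (K.piecewise (1 : X → ℝ) x j - x j) * w j = ∑ B, β B * ∑ j ∈ K \ B, w j := by
    have h1 : ∀ j, (K.piecewise (1 : X → ℝ) x j - x j) * w j =
        ∑ B, β B * (if j ∈ K \ B then w j else 0) := fun j => by
      by_cases hj : j ∈ K
      · have : 1 - x j = ∑ B, β B * (1 - indicatorVec B j) := by
          simp only [mul_sub, mul_one, Finset.sum_sub_distrib, hβ1, ← hx]
        simp only [Finset.piecewise_eq_of_mem _ _ _ hj, Pi.one_apply, this, Finset.sum_mul]
        refine Finset.sum_congr rfl fun B _ => ?_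
        by_cases hB : j ∈ B <;> simp [indicatorVec, hB, hj]
      · simp [hj]
    simp only [h1]
    rw [Finset.sum_comm]
    refine Finset.sum_congr rfl fun B _ => ?_
    rw [← Finset.mul_sum, Finset.sum_ite_mem, Finset.univ_inter]
  have e2 : ∑ j, (x j - (x j - m j)) * w j = ∑ B, β B * ∑ i ∈ I B, w i := by
    simp only [sub_sub_cancel, hm, Finset.sum_mul]
    rw [Finset.sum_comm]
    refine Finset.sum_congr rfl fun B _ => ?_
    simp [indicatorVec, Finset.mul_sum]
  refine ⟨fun k => x k - m k, fun i => ⟨sub_nonneg.2 (hmx i), sub_le_self _ (hm0 i)⟩,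
    fun i hi => by simp [hmC i hi], ?_⟩
  have h3 : ∑ B, β B * ∑ j ∈ K \ B, w j ≤ ∑ B, β B * ∑ i ∈ I B, w i :=
    Finset.sum_le_sum fun B _ => hIw B
  rw [e1] at hup
  rw [e2] at hdown
  linarith

/-- Deleting elements of probability at most `t` keeps a `1 - t` fraction of the value. -/
theorem multilinear_piecewise_zero_le {f : Finset X → ℝ} (hf : IsSubmodular f)
    (hf0 : ∀ S, 0 ≤ f S) {t : ℝ} (ht0 : 0 < t) (ht1 : t ≤ 1) {z : X → ℝ} (C : Finset X)
    (hz : ∀ i, 0 ≤ z i ∧ z i ≤ 1) (hzt : ∀ i ∉ C, z i ≤ t) :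
    (1 - t) * multilinear f (C.piecewise z 0) ≤ multilinear f z := by
  have hy : ∀ i, 0 ≤ C.piecewise z (fun k => z k / t) i ∧
      C.piecewise z (fun k => z k / t) i ≤ 1 := fun i => by
    by_cases hi : i ∈ C
    · simpa [hi] using hz i
    · simpa [hi] using ⟨div_nonneg (hz i).1 ht0.le, (div_le_one ht0).2 (hzt i hi)⟩
  -- Write `z` as `1 - t` times its truncation to `C` plus `t` times the point with coordinates off
  -- `C` divided by `t`; the latter has nonnegative value.
  have h1 := multilinear_concave_of_le hf (x := C.piecewise z 0)
    (y := C.piecewise z fun k => z k / t) (z := z) (s := t)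
    (fun i => by by_cases hi : i ∈ C <;> simp [hi, (hz i).1])
    (fun i => by
      by_cases hi : i ∈ C
      · simp [hi]
      · simpa [hi] using div_nonneg (hz i).1 ht0.le)
    (fun i => (hy i).2) ht0.le ht1 (fun i => by
      by_cases hi : i ∈ C
      · simp only [Finset.piecewise_eq_of_mem _ _ _ hi]; ring
      · simp only [Finset.piecewise_eq_of_notMem _ _ _ hi, Pi.zero_apply]; field_simp; ring)
  linarith [mul_nonneg ht0.le (multilinear_nonneg hf0 hy)]

/-- For a point on `C` that is `t` off `K`, its value and that of the point with the
coordinates in `K` raised to `1` add up to at least `f C`. -/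
theorem le_multilinear_add_multilinear {f : Finset X → ℝ} (hf : IsSubmodular f)
    (hf0 : ∀ S, 0 ≤ f S) {t : ℝ} (ht : 1 / 2 ≤ t) (ht1 : t ≤ 1) {x : X → ℝ}
    (hx : ∀ i, 0 ≤ x i ∧ x i ≤ 1) {K C : Finset X} (hKC : K ⊆ C)
    (hxt : ∀ i ∈ C, i ∉ K → x i = t) :
    f C ≤ multilinear f (C.piecewise x 0) +
      multilinear f (C.piecewise (K.piecewise 1 x) 0) := by
  -- This point is `1` on `K` and `t` on `C \ K`, so its value is at least `(1 - t) f(K) + t f(C)`.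
  have hb := multilinear_concave_of_le hf (x := indicatorVec K) (y := indicatorVec C)
    (z := C.piecewise (K.piecewise 1 x) 0) (s := t)
    (fun i => by unfold indicatorVec; split_ifs <;> norm_num)
    (fun i => by
      by_cases hi : i ∈ K
      · simp [indicatorVec, hi, hKC hi]
      · by_cases hC : i ∈ C <;> simp [indicatorVec, hi, hC])
    (fun i => by unfold indicatorVec; split_ifs <;> norm_num) (by linarith) ht1 (fun i => by
      by_cases hi : i ∈ K
      · simp [indicatorVec, hi, hKC hi]
      · by_cases hC : i ∈ C
        · simp [indicatorVec, hi, hC, hxt i hC hi]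
        · simp [indicatorVec, hi, hC])
  rw [multilinear_indicatorVec, multilinear_indicatorVec] at hb
  set a := K.piecewise x 0 with ha_def
  set c := K.piecewise x (indicatorVec C) with hc_def
  have hc : ∀ i, 0 ≤ c i ∧ c i ≤ 1 := fun i => by
    by_cases hi : i ∈ K
    · simpa [hc_def, hi] using hx i
    · by_cases hC : i ∈ C <;> simp [hc_def, indicatorVec, hi, hC]
  have ha : ∀ i, 0 ≤ a i ∧ a i ≤ c i := fun i => by
    by_cases hi : i ∈ K
    · simpa [ha_def, hc_def, hi] using (hx i).1
    · by_cases hC : i ∈ C <;> simp [ha_def, hc_def, indicatorVec, hi, hC]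
  -- The other point equals `x` on `K` and `t` on `C \ K`; its value is at least `t F(c)`, where `c`
  -- is raised to `1` on `C \ K`.
  have hac := multilinear_concave_of_le hf (x := a) (y := c) (z := C.piecewise x 0) (s := t)
    (fun i => (ha i).1) (fun i => (ha i).2) (fun i => (hc i).2) (by linarith) ht1 (fun i => by
      by_cases hi : i ∈ K
      · simp only [ha_def, hc_def, Finset.piecewise_eq_of_mem _ _ _ hi,
          Finset.piecewise_eq_of_mem _ _ _ (hKC hi)]
        ring
      · by_cases hC : i ∈ C
        · simp [ha_def, hc_def, indicatorVec, hi, hC, hxt i hC hi]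
        · simp [ha_def, hc_def, indicatorVec, hi, hC])
  have hFa := multilinear_nonneg hf0 fun i => ⟨(ha i).1, (ha i).2.trans (hc i).2⟩
  have hFc := multilinear_nonneg hf0 hc
  -- Every set `S` in the support of `c` satisfies `S ∪ K = C`, so submodularity and `f (S ∩ K) ≥ 0`
  -- apply.
  have hcK : f C - f K ≤ multilinear f c := multilinear_le_of_forall hc _ fun S h1 h0 => by
    have hSC : S ⊆ C := fun i hi => by
      by_contra hC
      have hK : i ∉ K := fun h => hC (hKC h)
      exact h0 i hi (by simp [hc_def, indicatorVec, hC, hK])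
    have hU : S ∪ K = C := by
      refine (Finset.union_subset hSC hKC).antisymm fun i hi => ?_
      by_cases hK : i ∈ K
      · exact Finset.mem_union_right _ hK
      · exact Finset.mem_union_left _ (h1 i (by simp [hc_def, indicatorVec, hK, hi]))
    have := hf S K
    rw [hU] at this
    linarith [hf0 (S ∩ K)]
  -- Here `t ≥ 1/2` enters: `t F(c) ≥ (1 - t) F(c) ≥ (1 - t)(f(C) - f(K))`, which cancels the `f(K)`
  -- term.
  nlinarith [mul_nonneg (sub_nonneg.2 ht1) hFa, mul_le_mul_of_nonneg_left hcK (sub_nonneg.2 ht1),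
    mul_nonneg (sub_nonneg.2 ht) hFc]

theorem opt_attained (M : Matroid X) (f : Finset X → ℝ) :
    ∃ C : Finset X, M.IsBase (C : Set X) ∧ opt M f = f C := by
  have hne : (f '' {B : Finset X | M.IsBase (B : Set X)}).Nonempty :=
    Set.Nonempty.image _ (exists_finset_isBase M)
  obtain ⟨C, hC, h⟩ := hne.csSup_mem ((Set.toFinite _).image f)
  exact ⟨C, hC, h.symm⟩

/-- The value of a fractional local optimum. -/
theorem multilinear_localOptimum_ge {M : Matroid X} {f : Finset X → ℝ} (hf : IsSubmodular f)
    (hf0 : ∀ S, 0 ≤ f S) {t : ℝ} (ht : 1 / 2 ≤ t) (ht1 : t ≤ 1) {r q : ℕ} (hq : 0 < q)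
    (htrq : t = (r : ℝ) / q) {x : X → ℝ} (hx : x ∈ boxedBasePolytope M t)
    (hgrid : IsGridPoint (1 / (q : ℝ)) x)
    (hloc : ∀ i j, ¬ IsImproving M f t (1 / (q : ℝ)) x i j) :
    1 / 2 * (1 - t) * opt M f ≤ multilinear f x := by
  obtain ⟨C, hC, hopt⟩ := opt_attained M f
  obtain ⟨β, hβ0, hβb, hβ1, hβx⟩ := (mem_basePolytope_iff M x).1 hx.1
  have hx01 : ∀ i, 0 ≤ x i ∧ x i ≤ 1 := fun i => ⟨(hx.2 i).1, (hx.2 i).2.trans ht1⟩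
  -- Elements of `C` already at the cap `t` cannot be raised, so only those in `K` are exchanged in.
  obtain ⟨K, hK⟩ : ∃ K : Finset X, ∀ k, k ∈ K ↔ k ∈ C ∧ x k < t :=
    ⟨C.filter fun k => x k < t, fun k => Finset.mem_filter⟩
  have hKC : K ⊆ C := fun k hk => ((hK k).1 hk).1
  have hmatch : ∀ B, β B ≠ 0 → ∃ I ⊆ B \ C,
      ∑ j ∈ K \ B, partialDeriv j f x ≤ ∑ i ∈ I, partialDeriv i f x := by
    intro B hB
    obtain ⟨σ, hσ, hσB⟩ := exists_exchange_matching (hβb B hB) hC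
    let J : Finset {j // j ∈ C \ B} := Finset.univ.filter fun j => j.1 ∈ K
    refine ⟨J.map ⟨σ, hσ⟩, fun i hi => ?_, ?_⟩
    · obtain ⟨j, -, rfl⟩ := Finset.mem_map.1 hi
      exact (hσB j).1
    · have e : K \ B = J.map (Function.Embedding.subtype _) := by
        ext k
        simp only [J, Finset.mem_map, Finset.mem_filter, Finset.mem_univ, true_and,
          Function.Embedding.coe_subtype, Subtype.exists, exists_and_left, exists_prop,
          exists_eq_right_right, Finset.mem_sdiff]
        exact ⟨fun h => ⟨h.1, hKC h.1, h.2⟩, fun h => ⟨h.1, h.2.2⟩⟩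
      rw [e, Finset.sum_map, Finset.sum_map]
      refine Finset.sum_le_sum fun j hj => ?_
      have hjB := (Finset.mem_sdiff.1 j.2).2
      have hiB := (Finset.mem_sdiff.1 (hσB j).1).1
      exact partialDeriv_le_of_not_isImproving hf (by positivity) hx01
        (fun h : σ j = j.1 => hjB (h ▸ hiB))
        (exchange_mem_boxedBasePolytope hβ0 hβb hβ1 hβx hq htrq hx hgrid hB hiB hjB
          ((hK _).1 (Finset.mem_filter.1 hj).2).2 (hσB j).2) (hloc _ _)
  obtain ⟨z, hz, hzC, hle⟩ := exists_lowering_of_matching hf hx01 hβ0 hβ1 hβx hmatch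
  have h1 := multilinear_piecewise_zero_le hf hf0 (by linarith) ht1 (z := z) C
    (fun i => ⟨(hz i).1, (hz i).2.trans (hx01 i).2⟩) fun i _ => (hz i).2.trans (hx.2 i).2
  have h2 := multilinear_piecewise_zero_le hf hf0 (by linarith) ht1 (z := K.piecewise 1 x) C
    (fun i => by
      by_cases hi : i ∈ K
      · simp [hi]
      · simpa [hi] using hx01 i)
    fun i hi => by
      rw [Finset.piecewise_eq_of_notMem _ _ _ fun h => hi (hKC h)]
      exact (hx.2 i).2
  have h3 := le_multilinear_add_multilinear hf hf0 ht ht1 hx01 hKC fun i hi hiK =>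
    (hx.2 i).2.antisymm (not_lt.1 fun h => hiK ((hK i).2 ⟨hi, h⟩))
  have e : C.piecewise z 0 = C.piecewise x 0 := by
    ext i
    by_cases hi : i ∈ C <;> simp [hi, hzC]
  rw [e] at h1
  rw [hopt]
  linarith [mul_le_mul_of_nonneg_left h3 (sub_nonneg.2 ht1)]

/-! ### The whole algorithm. -/

/-- The invariant of the whole algorithm. -/
def StateInvariant (M : Matroid X) (t δ : ℝ) : State X → Prop
  | .start => True
  | .search x => x ∈ boxedBasePolytope M t ∧ IsGridPoint δ x
  | .round y T => RoundStateInvariant M (.round y T)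
  | .done B => RoundStateInvariant M (.done B)

theorem RoundStateInvariant.stateInvariant {M : Matroid X} {t δ : ℝ} {s : State X}
    (hs : RoundStateInvariant M s) : StateInvariant M t δ s := by
  cases s with
  | start => exact hs.elim
  | search => exact hs.elim
  | round => exact hs
  | done => exact hs

/-- The grid points in the box that are better than `x`. -/
def betterGridPoints (f : Finset X → ℝ) (t δ : ℝ) (x : X → ℝ) : Set (X → ℝ) :=
  {z | z ∈ gridBox X δ t ∧ multilinear f x < multilinear f z}

/-- The termination measure of the whole algorithm. -/
noncomputable def stateMeasure (f : Finset X → ℝ) (t δ : ℝ) : State X → ℕ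
  -- The constant part is the bound of `roundMeasure_le`, so every search state lies above every
  -- rounding state, and the start above all.
  | .start => Fintype.card X * (2 * (Fintype.card X + 1)) +
      (Fintype.card X + 1 + Fintype.card X) + 3 +
      (gridBox X δ t).ncard
  | .search x => Fintype.card X * (2 * (Fintype.card X + 1)) +
      (Fintype.card X + 1 + Fintype.card X) + 2 + (betterGridPoints f t δ x).ncard
  | .round y T => roundStateMeasure (.round y T)
  | .done B => roundStateMeasure (.done B)

theorem RoundStateInvariant.stateMeasure_eq {M : Matroid X} (f : Finset X → ℝ) (t δ : ℝ)
    {s : State X} (hs : RoundStateInvariant M s) : stateMeasure f t δ s = roundStateMeasure s := by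
  cases s with
  | start => exact hs.elim
  | search => exact hs.elim
  | round => rfl
  | done => rfl

theorem state_step {M : Matroid X} {f : Finset X → ℝ} {t δ p : ℝ}
    (hfin : (gridBox X δ t).Finite)
    {s s₁ s₂ : State X} (h : Step M f t δ s p s₁ s₂) (hs : StateInvariant M t δ s) :
    (StateInvariant M t δ s₁ ∧ StateInvariant M t δ s₂) ∧
      stateMeasure f t δ s₁ < stateMeasure f t δ s ∧
      stateMeasure f t δ s₂ < stateMeasure f t δ s := by
  have hround : RoundStateInvariant M s → _ := fun hs' => by
    obtain ⟨⟨i1, i2⟩, m1, m2⟩ := round_step h hs'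
    rw [← i1.stateMeasure_eq f t δ, ← hs'.stateMeasure_eq f t δ] at m1
    rw [← i2.stateMeasure_eq f t δ, ← hs'.stateMeasure_eq f t δ] at m2
    exact (⟨⟨i1.stateInvariant, i2.stateInvariant⟩, m1, m2⟩ :
      (StateInvariant M t δ s₁ ∧ StateInvariant M t δ s₂) ∧
      stateMeasure f t δ s₁ < stateMeasure f t δ s ∧
      stateMeasure f t δ s₂ < stateMeasure f t δ s)
  cases h with
  | start x hx hgrid =>
    have h1 : stateMeasure f t δ (.search x) < stateMeasure f t δ .start := by
      have := Set.ncard_le_ncard (s := betterGridPoints f t δ x) (fun z hz => hz.1) hfin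
      simp only [stateMeasure]
      omega
    exact ⟨⟨⟨hx, hgrid⟩, ⟨hx, hgrid⟩⟩, h1, h1⟩
  | improve x i j h =>
    have hgrid := hs.2.add_smul j i
    have h1 : stateMeasure f t δ (.search (x + δ • (basisVec j - basisVec i))) <
        stateMeasure f t δ (.search x) := by
      -- The new point is better than the old one but not than itself, so the set of better grid
      -- points shrinks strictly.
      have := Set.ncard_lt_ncard (s := betterGridPoints f t δ (x + δ • (basisVec j - basisVec i)))
        (t := betterGridPoints f t δ x)
        ⟨fun z hz => ⟨hz.1, h.2.trans hz.2⟩, fun hsub =>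
          lt_irrefl _ (hsub (show _ ∈ betterGridPoints f t δ x from ⟨⟨hgrid, h.1.2⟩, h.2⟩)).2⟩
        (hfin.subset fun z hz => hz.1)
      simp only [stateMeasure]
      omega
    exact ⟨⟨⟨h.1, hgrid⟩, ⟨h.1, hgrid⟩⟩, h1, h1⟩
  | finish x h =>
    have h1 : RoundStateInvariant M (.round x Finset.univ) :=
      roundInvariant_univ ((mem_basePolytope_iff_memBasePolyhedron M x).1 hs.1.1)
    have h2 : stateMeasure f t δ (.round x Finset.univ) < stateMeasure f t δ (.search x) := by
      have := roundMeasure_le x Finset.univ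
      simp only [stateMeasure, roundStateMeasure]
      omega
    exact ⟨⟨h1, h1⟩, h2, h2⟩
  | pipage => exact hround hs
  | restart => exact hround hs
  | output => exact hround hs

theorem state_progress {M : Matroid X} {f : Finset X → ℝ} {t δ : ℝ}
    (hstart : ∃ x ∈ boxedBasePolytope M t, IsGridPoint δ x) {s : State X}
    (hs : StateInvariant M t δ s) :
    (∃ B, s = .done B) ∨ ∃ p s₁ s₂, Step M f t δ s p s₁ s₂ := by
  cases s with
  | start =>
    obtain ⟨x, hx, hgrid⟩ := hstart
    exact Or.inr ⟨_, _, _, .start x hx hgrid⟩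
  | search x =>
    by_cases h : ∃ i j, IsImproving M f t δ x i j
    · obtain ⟨i, j, h⟩ := h
      exact Or.inr ⟨_, _, _, .improve x i j h⟩
    · push Not at h
      exact Or.inr ⟨_, _, _, .finish x h⟩
  | round y T => exact round_progress f t δ hs
  | done B => exact round_progress f t δ hs

theorem halts_of_invariant {M : Matroid X} {f : Finset X → ℝ} {t δ : ℝ}
    (I : State X → Prop) (m : State X → ℕ)
    (hstep : ∀ {p s s₁ s₂}, Step M f t δ s p s₁ s₂ → I s →
      (I s₁ ∧ I s₂) ∧ m s₁ < m s ∧ m s₂ < m s)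
    (hprog : ∀ {s}, I s → (∃ B, s = .done B) ∨ ∃ p s₁ s₂, Step M f t δ s p s₁ s₂)
    {s : State X} (hs : I s) : Halts M f t δ s := by
  have hnext : ∀ {s s'}, Next M f t δ s s' → I s → I s' ∧ m s' < m s := by
    rintro s s' ⟨p, s₁, s₂, h, rfl | rfl⟩ hs
    · exact ⟨(hstep h hs).1.1, (hstep h hs).2.1⟩
    · exact ⟨(hstep h hs).1.2, (hstep h hs).2.2⟩
  refine ⟨?_, fun s' hs' => ?_⟩
  · rintro ⟨u, rfl, hu⟩
    have hI : ∀ n, I (u n) := fun n => by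
      induction n with
      | zero => exact hs
      | succ n ih => exact (hnext (hu n) ih).1
    have hanti : StrictAnti fun n => m (u n) :=
      strictAnti_nat_of_succ_lt fun n => (hnext (hu n) (hI n)).2
    exact (RelEmbedding.natGT _ fun n => hanti (Nat.lt_succ_self n)).not_wellFounded
      (wellFounded_lt (α := ℕ))
  · have hI : I s' := by
      induction hs' with
      | refl => exact hs
      | tail _ h ih => exact (hnext h ih).1
    rcases hprog hI with h | ⟨p, s₁, s₂, h⟩
    · exact Or.inl h
    · exact Or.inr ⟨s₁, p, s₁, s₂, h, Or.inl rfl⟩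

/-- A lower bound for the mean value of the result from a given state on, if the local optima
have value at least `c`. -/
noncomputable def stateValue (f : Finset X → ℝ) (c : ℝ) : State X → ℝ
  | .start => c
  | .search _ => c
  | .round y T => roundValue (multilinear f) (.round y T)
  | .done B => roundValue (multilinear f) (.done B)

theorem RoundStateInvariant.stateValue_eq {M : Matroid X} (f : Finset X → ℝ) (c : ℝ)
    {s : State X} (hs : RoundStateInvariant M s) :
    stateValue f c s = roundValue (multilinear f) s := by
  cases s with
  | start => exact hs.elim
  | search => exact hs.elim
  | round => rfl
  | done => rfl

/-- The value is constantly `c` during the search; the passage from a local optimum to the rounding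
is where `hc` is needed. -/
theorem stateValue_step {M : Matroid X} {f : Finset X → ℝ} (hf : IsSubmodular f) {t δ p c : ℝ}
    (hc : ∀ x ∈ boxedBasePolytope M t, IsGridPoint δ x →
      (∀ i j, ¬ IsImproving M f t δ x i j) → c ≤ multilinear f x)
    {s s₁ s₂ : State X} (h : Step M f t δ s p s₁ s₂) (hs : StateInvariant M t δ s) :
    stateValue f c s ≤ p * stateValue f c s₁ + (1 - p) * stateValue f c s₂ := by
  have hround : RoundStateInvariant M s →
      stateValue f c s ≤ p * stateValue f c s₁ + (1 - p) * stateValue f c s₂ := fun hs' => by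
    obtain ⟨⟨i1, i2⟩, -⟩ := round_step h hs'
    rw [hs'.stateValue_eq, i1.stateValue_eq, i2.stateValue_eq]
    exact roundValue_step (pipageConvex_multilinear M hf) h hs'
  cases h with
  | start x hx hgrid => simp [stateValue]
  | improve x i j h => simp [stateValue]
  | finish x h => simpa [stateValue, roundValue] using hc x hs.1 hs.2 h
  | pipage => exact hround hs
  | restart => exact hround hs
  | output => exact hround hs

end SubmodBases

theorem theorem4p6 {X : Type*} [Fintype X] [DecidableEq X]
    (M : Matroid X) (hM : M.E = Set.univ)
    (f : Finset X → ℝ) (hf : SubmodBases.IsSubmodular f) (hf0 : ∀ S, 0 ≤ f S)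
    (ν : ℝ) (hν1 : 1 ≤ ν) (hν2 : ν ≤ 2) (hpack : SubmodBases.HasFractionalBasePacking M ν)
    (t : ℝ) (ht : t = 1 / ν) (r q : ℕ) (hq : 0 < q) (htrq : t = (r : ℝ) / (q : ℝ)) :
    SubmodBases.Halts M f t (1 / (q : ℝ)) .start ∧
    (∃ μ : Finset X → ℝ, SubmodBases.Returns M f t (1 / (q : ℝ)) .start μ) ∧
    ∀ μ : Finset X → ℝ, SubmodBases.Returns M f t (1 / (q : ℝ)) .start μ →
      (∀ B, 0 ≤ μ B) ∧ ∑ B : Finset X, μ B = 1 ∧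
      (∀ B, μ B ≠ 0 → M.IsBase (B : Set X)) ∧
      1 / 2 * (1 - t) * SubmodBases.opt M f ≤ ∑ B : Finset X, μ B * f B := by
  -- The bound `ν ≤ 2` serves only to give `t ≥ 1/2`.
  have ht2 : 1 / 2 ≤ t := by rw [ht]; exact one_div_le_one_div_of_le (by linarith) hν2
  have ht1 : t ≤ 1 := by rw [ht]; exact (div_le_one (by linarith)).2 hν1
  have hfin := SubmodBases.finite_gridBox (X := X) hq t
  have hstart := SubmodBases.exists_start hν1 hpack ht hq htrq
  have h0 : SubmodBases.StateInvariant M t (1 / (q : ℝ)) .start := trivial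
  refine ⟨SubmodBases.halts_of_invariant _ _ (SubmodBases.state_step hfin)
    (SubmodBases.state_progress hstart) h0,
    SubmodBases.exists_returns_of_measure _ _ (SubmodBases.state_step hfin)
    (SubmodBases.state_progress hstart) _ h0, fun μ hμ => ?_⟩
  obtain ⟨h1, h2, h3⟩ := hμ.isProbability _ (fun h hs => (SubmodBases.state_step hfin h hs).1)
    id h0
  refine ⟨h1, h2, h3, ?_⟩
  have h4 := hμ.bound _ (SubmodBases.stateValue f (1 / 2 * (1 - t) * SubmodBases.opt M f))
    (fun h hs => ⟨(SubmodBases.state_step hfin h hs).1, SubmodBases.stateValue_step hf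
      (fun x hx hgrid hloc =>
        SubmodBases.multilinear_localOptimum_ge hf hf0 ht2 ht1 hq htrq hx hgrid hloc) h hs⟩) h0
  simpa [SubmodBases.stateValue, SubmodBases.roundValue,
    SubmodBases.multilinear_indicatorVec] using h4
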